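/- Let $n\ge 0$, let $S_n$ be the symmetric group, and for $k\ge1$ let $\mathcal C_k\subset S_n$ be the conjugacy class of cycle type $[k,1^{n-k}]$ (empty if $k>n$) and $T_k=\sum_{\sigma\in\mathcal C_k}\sigma\in\mathbb C(S_n)$. Let $\mathcal K(n)\subset\mathbb C(S_n)\otimes\mathbb C(S_n)$ be the subalgebra spanned by the elements $$\frac1{n!}\sum_{\mu\in S_n}\mu\tau_1\mu^{-1}\otimes\mu\tau_2\mu^{-1},\qquad \tau_1,\tau_2\in S_n .$$ The reconnection operators are the operators of left multiplication on $\mathcal K(n)$ by its central elements $$T^{(1)}_k=T_k\otimes 1,\qquad T^{(2)}_k=1\otimes T_k,\qquad T^{(3)}_k=\sum_{\sigma\in\mathcal C_k}\sigma\otimes\sigma .$$ Let $k_*(n)$ be the least $K\ge 0$ such that the elements $T^{(i)}_k$ with $i\in\{1,2,3\}$, $1\le k\le K$, generate the centre of $\mathcal K(n)$ as a unital algebra. For a Young diagram $R$ with $n$ boxes let $\chi_R$ and $d(R)$ be the character and the dimension of the irreducible representation $D^R$ of $S_n$ labelled by $R$ (the Specht module). For a triple $(R_1,R_2,R_3)$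 of Young diagrams with $n$ boxes, the Fourier subspace $V^{R_1,R_2,R_3}\subset\mathcal K(n)$ is the span of the elements $$\frac{d(R_1)d(R_2)}{(n!)^2}\sum_{\sigma_1,\sigma_2\in S_n}\operatorname{tr}_{R_1\otimes R_2}\big((D^{R_1}(\sigma_1)\otimes D^{R_2}(\sigma_2))\,f\,g\big)\;\sigma_1\otimes\sigma_2,$$ where $f:R_3\to R_1\otimes R_2$ and $g:R_1\otimes R_2\to R_3$ run over the $S_n$-equivariant linear maps. Let $\tilde k_*$ be any integer with $k_*(n)\le\tilde k_*\le n$. Then for all $i\in\{1,2,3\}$ and $2\le k\le\tilde k_*$ the operator $T^{(i)}_k$ acts on $V^{R_1,R_2,R_3}$ as multiplication by the scalar $\chi_{R_i}(T_k)/d(R_i)$, and the list of these eigenvalues uniquely determines the triple: if $(R_1,R_2,R_3)$ and $(R_1',R_2',R_3')$ are triples of Young diagrams with $n$ boxes such that $$\frac{\chi_{R_i}(T_k)}{d(R_i)}=\frac{\chi_{R_i'}(T_k)}{d(R_i')}\qquad\text{for all } i\in\{1,2,3\},\ 2\le k\le\tilde k_*,$$ then $R_i=R_i'$ for $i=1,2,3$.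 -/

import Mathlib

open scoped TensorProduct

noncomputable section

namespace RibbonGraph

/-- The group algebra `ℂ(S_n)`. -/
abbrev GroupAlg (n : ℕ) : Type := MonoidAlgebra ℂ (Equiv.Perm (Fin n))

/-- The algebra `ℂ(S_n) ⊗ ℂ(S_n)`. -/
abbrev GroupAlg2 (n : ℕ) : Type := GroupAlg n ⊗[ℂ] GroupAlg n

/-- A permutation, as an element of `ℂ(S_n)`. -/
def perm {n : ℕ} (σ : Equiv.Perm (Fin n)) : GroupAlg n := MonoidAlgebra.of ℂ _ σ

/-- The basis element `σ₁ ⊗ σ₂` of `ℂ(S_n) ⊗ ℂ(S_n)`. -/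
def permPair {n : ℕ} (σ₁ σ₂ : Equiv.Perm (Fin n)) : GroupAlg2 n := perm σ₁ ⊗ₜ[ℂ] perm σ₂

/-! ### The algebra of bi-partite ribbon graphs -/

/-- The element `E = (1/n!) ∑_μ μ τ₁ μ⁻¹ ⊗ μ τ₂ μ⁻¹` attached to the pair `(τ₁, τ₂)`. It depends only
on the orbit of the pair under simultaneous conjugation, i.e. on the ribbon graph of the pair. -/
def ribbonVector {n : ℕ} (τ₁ τ₂ : Equiv.Perm (Fin n)) : GroupAlg2 n :=
  ((n.factorial : ℂ)⁻¹) •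
    ∑ μ : Equiv.Perm (Fin n), permPair (μ * τ₁ * μ⁻¹) (μ * τ₂ * μ⁻¹)

/-- The vector space spanned by all the elements `E`. -/
def ribbonSpace (n : ℕ) : Submodule ℂ (GroupAlg2 n) :=
  Submodule.span ℂ
    (Set.range fun τ : Equiv.Perm (Fin n) × Equiv.Perm (Fin n) => ribbonVector τ.1 τ.2)

lemma permPair_mul {n : ℕ} (a b c d : Equiv.Perm (Fin n)) :
    permPair a b * permPair c d = permPair (a * c) (b * d) := by
  simp [permPair, perm]

lemma permPair_one {n : ℕ} : permPair (1 : Equiv.Perm (Fin n)) 1 = 1 := by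
  simp only [permPair, perm, map_one, Algebra.TensorProduct.one_def]

lemma span_permPair (n : ℕ) (x : GroupAlg2 n) :
    x ∈ Submodule.span ℂ (Set.range fun τ : Equiv.Perm (Fin n) × Equiv.Perm (Fin n) =>
      permPair τ.1 τ.2) := by
  induction x using TensorProduct.induction_on with
  | zero => exact Submodule.zero_mem _
  | add x y hx hy => exact Submodule.add_mem _ hx hy
  | tmul a b =>
    induction a using MonoidAlgebra.induction_on with
    | of σ =>
      induction b using MonoidAlgebra.induction_on with
      | of τ => exact Submodule.subset_span ⟨(σ, τ), rfl⟩
      | add f g hf hg => rw [TensorProduct.tmul_add]; exact Submodule.add_mem _ hf hg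
      | smul r f hf => rw [TensorProduct.tmul_smul]; exact Submodule.smul_mem _ _ hf
    | add f g hf hg => rw [TensorProduct.add_tmul]; exact Submodule.add_mem _ hf hg
    | smul r f hf => rw [← TensorProduct.smul_tmul']; exact Submodule.smul_mem _ _ hf

/-- The average over the diagonal conjugation action of `S_n`. -/
def conjAverage (n : ℕ) : GroupAlg2 n →ₗ[ℂ] GroupAlg2 n :=
  ((n.factorial : ℂ)⁻¹) • ∑ μ : Equiv.Perm (Fin n),
    (LinearMap.mulLeft ℂ (permPair μ μ)) ∘ₗ (LinearMap.mulRight ℂ (permPair μ⁻¹ μ⁻¹))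

lemma conjAverage_apply {n : ℕ} (x : GroupAlg2 n) :
    conjAverage n x = ((n.factorial : ℂ)⁻¹) • ∑ μ : Equiv.Perm (Fin n),
      permPair μ μ * (x * permPair μ⁻¹ μ⁻¹) := by
  simp [conjAverage]

lemma conjAverage_permPair {n : ℕ} (σ τ : Equiv.Perm (Fin n)) :
    conjAverage n (permPair σ τ) = ribbonVector σ τ := by
  simp only [conjAverage_apply, ribbonVector, permPair_mul, mul_assoc]

lemma conjAverage_mem {n : ℕ} (x : GroupAlg2 n) : conjAverage n x ∈ ribbonSpace n := by
  have hx := span_permPair n x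
  induction hx using Submodule.span_induction with
  | mem x h =>
    obtain ⟨τ, rfl⟩ := h
    rw [conjAverage_permPair]
    exact Submodule.subset_span ⟨τ, rfl⟩
  | zero => simp
  | add x y _ _ hx hy => rw [map_add]; exact Submodule.add_mem _ hx hy
  | smul a x _ hx => rw [map_smul]; exact Submodule.smul_mem _ _ hx

/-- The span of the elements `E` is the commutant of the diagonally embedded `S_n`. -/
lemma mem_ribbonSpace_iff {n : ℕ} (x : GroupAlg2 n) :
    x ∈ ribbonSpace n ↔ ∀ γ : Equiv.Perm (Fin n), permPair γ γ * x = x * permPair γ γ := by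
  constructor
  · intro hx γ
    induction hx using Submodule.span_induction with
    | mem x h =>
      obtain ⟨τ, rfl⟩ := h
      simp only [ribbonVector, mul_smul_comm, smul_mul_assoc, Finset.mul_sum, Finset.sum_mul,
        permPair_mul]
      congr 1
      refine Fintype.sum_equiv (Equiv.mulLeft γ) _ _ fun μ => ?_
      simp [mul_assoc]
    | zero => simp
    | add x y _ _ hx hy => rw [mul_add, add_mul, hx, hy]
    | smul a x _ hx => rw [mul_smul_comm, smul_mul_assoc, hx]
  · intro h
    have key : conjAverage n x = x := by
      rw [conjAverage_apply]
      have : ∀ μ : Equiv.Perm (Fin n), permPair μ μ * (x * permPair μ⁻¹ μ⁻¹) = x := fun μ => by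
        rw [← mul_assoc, h μ, mul_assoc, permPair_mul, mul_inv_cancel, permPair_one, mul_one]
      simp only [this, Finset.sum_const, Finset.card_univ, Fintype.card_perm, Fintype.card_fin]
      rw [← Nat.cast_smul_eq_nsmul ℂ, smul_smul, inv_mul_cancel₀, one_smul]
      exact_mod_cast n.factorial_ne_zero
    rw [← key]
    exact conjAverage_mem x

/-- The algebra `𝒦(n)` of bi-partite ribbon graphs with `n` edges: the span of the elements `E`,
with the multiplication of `ℂ(S_n) ⊗ ℂ(S_n)`. -/
def ribbonAlgebra (n : ℕ) : Subalgebra ℂ (GroupAlg2 n) :=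
  (ribbonSpace n).toSubalgebra
    ((mem_ribbonSpace_iff _).2 fun γ => by rw [mul_one, one_mul])
    (fun x y hx hy => (mem_ribbonSpace_iff _).2 fun γ => by
      rw [← mul_assoc, (mem_ribbonSpace_iff x).1 hx γ, mul_assoc,
        (mem_ribbonSpace_iff y).1 hy γ, mul_assoc])

lemma mem_ribbonAlgebra_iff {n : ℕ} (x : GroupAlg2 n) :
    x ∈ ribbonAlgebra n ↔ ∀ γ : Equiv.Perm (Fin n), permPair γ γ * x = x * permPair γ γ :=
  mem_ribbonSpace_iff x

/-! ### The reconnection operators -/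

open Classical in
/-- The conjugacy class `𝒞_k` of cycle type `[k, 1^{n-k}]` in `S_n`, for `1 ≤ k ≤ n`
(for `k = 1` it is the class of the identity). -/
def cycleClass (n k : ℕ) : Finset (Equiv.Perm (Fin n)) :=
  {σ | σ.partition.parts = k ::ₘ Multiset.replicate (n - k) 1}

lemma conj_mem_cycleClass {n k : ℕ} (γ σ : Equiv.Perm (Fin n)) :
    γ * σ * γ⁻¹ ∈ cycleClass n k ↔ σ ∈ cycleClass n k := by
  have h : (γ * σ * γ⁻¹).partition = σ.partition :=
    (Equiv.Perm.partition_eq_of_isConj.1 (isConj_iff.2 ⟨γ, rfl⟩)).symm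
  simp [cycleClass, h]

lemma sum_cycleClass_conj {n k : ℕ} {M : Type*} [AddCommMonoid M]
    (f : Equiv.Perm (Fin n) → M) (γ : Equiv.Perm (Fin n)) :
    ∑ σ ∈ cycleClass n k, f (γ * σ * γ⁻¹) = ∑ σ ∈ cycleClass n k, f σ :=
  Finset.sum_equiv (MulAut.conj γ).toEquiv
    (fun σ => by simp [conj_mem_cycleClass]) (fun σ _ => by simp)

/-- The central element `T_k = ∑_{σ ∈ 𝒞_k} σ` of `ℂ(S_n)`. -/
def cycleSum (n k : ℕ) : GroupAlg n := ∑ σ ∈ cycleClass n k, perm σ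

/-- The elements `T_k ⊗ 1`, `1 ⊗ T_k` and `∑_{σ ∈ 𝒞_k} σ ⊗ σ` of `ℂ(S_n) ⊗ ℂ(S_n)`; the three
upper indices are `0, 1, 2` here. -/
def reconnectionElement (n : ℕ) (i : Fin 3) (k : ℕ) : GroupAlg2 n :=
  ![cycleSum n k ⊗ₜ[ℂ] 1, 1 ⊗ₜ[ℂ] cycleSum n k, ∑ σ ∈ cycleClass n k, permPair σ σ] i

lemma reconnectionElement_mem (n : ℕ) (i : Fin 3) (k : ℕ) :
    reconnectionElement n i k ∈ ribbonAlgebra n := by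
  have key : ∀ (f g : Equiv.Perm (Fin n) → Equiv.Perm (Fin n)),
      (∀ γ σ, f (γ * σ * γ⁻¹) = γ * f σ * γ⁻¹) → (∀ γ σ, g (γ * σ * γ⁻¹) = γ * g σ * γ⁻¹) →
      ∑ σ ∈ cycleClass n k, permPair (f σ) (g σ) ∈ ribbonAlgebra n := by
    intro f g hf hg
    rw [mem_ribbonAlgebra_iff]
    intro γ
    conv_rhs => rw [← sum_cycleClass_conj (fun σ => permPair (f σ) (g σ)) γ, Finset.sum_mul]
    rw [Finset.mul_sum]
    refine Finset.sum_congr rfl fun σ _ => ?_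
    simp only [permPair_mul, hf, hg, inv_mul_cancel_right]
  have h1 : (perm (1 : Equiv.Perm (Fin n))) = 1 := by
    simp only [perm, map_one]
  fin_cases i
  · have := key id (fun _ => 1) (by simp) (by simp)
    simpa [reconnectionElement, cycleSum, TensorProduct.sum_tmul, permPair, h1] using this
  · have := key (fun _ => 1) id (by simp) (by simp)
    simpa [reconnectionElement, cycleSum, TensorProduct.tmul_sum, permPair, h1] using this
  · exact key id id (by simp) (by simp)

/-- The element `T_k^{(i)}` of `𝒦(n)`. -/
def reconnection (n : ℕ) (i : Fin 3) (k : ℕ) : ribbonAlgebra n :=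
  ⟨reconnectionElement n i k, reconnectionElement_mem n i k⟩

/-- The reconnection operator `T_k^{(i)}`, acting on `𝒦(n)` by left multiplication. -/
def reconnectionOperator (n : ℕ) (i : Fin 3) (k : ℕ) : Module.End ℂ (ribbonAlgebra n) :=
  LinearMap.mulLeft ℂ (reconnection n i k)

/-- The elements `T_k^{(i)}`, `i = 1, 2, 3`, `1 ≤ k ≤ K`, generate the centre of `𝒦(n)`: sums of
products of them exhaust it. -/
def GeneratesCentre (n K : ℕ) : Prop :=
  Algebra.adjoin ℂ {x : ribbonAlgebra n | ∃ i : Fin 3, ∃ k ∈ Finset.Icc 1 K,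
    x = reconnection n i k} = Subalgebra.center ℂ (ribbonAlgebra n)

/-- `k_*(n)`: the least `K` such that the `T_k^{(i)}` with `k ≤ K` generate the centre of `𝒦(n)`. -/
def kStar (n : ℕ) : ℕ := sInf {K | GeneratesCentre n K}

/-! ### Young diagrams and the irreducible representations of `S_n` -/

/-- Young diagrams with `n` boxes. -/
abbrev Diagram (n : ℕ) : Type := {R : YoungDiagram // R.card = n}

/-- A tableau of shape `R`: a filling of the boxes of `R` with `0, …, n - 1`. -/
def tableau {n : ℕ} (R : Diagram n) : Fin n ≃ R.1.cells :=
  (R.1.cells.equivFinOfCardEq R.2).symm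

open Classical in
/-- The permutations preserving each row of the tableau. -/
def rowStabilizer {n : ℕ} (R : Diagram n) : Finset (Equiv.Perm (Fin n)) :=
  {σ | ∀ x, (tableau R (σ x)).1.1 = (tableau R x).1.1}

open Classical in
/-- The permutations preserving each column of the tableau. -/
def colStabilizer {n : ℕ} (R : Diagram n) : Finset (Equiv.Perm (Fin n)) :=
  {σ | ∀ x, (tableau R (σ x)).1.2 = (tableau R x).1.2}

/-- The Young symmetrizer: the sum of the row-preserving permutations times the signed sum of the
column-preserving permutations. -/
def youngSymmetrizer {n : ℕ} (R : Diagram n) : GroupAlg n :=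
  (∑ σ ∈ rowStabilizer R, perm σ) *
    ∑ σ ∈ colStabilizer R, (((Equiv.Perm.sign σ : ℤˣ) : ℤ) : ℂ) • perm σ

/-- The Specht module of `R`: the left ideal of `ℂ(S_n)` generated by the Young symmetrizer. -/
def specht {n : ℕ} (R : Diagram n) : Submodule ℂ (GroupAlg n) :=
  LinearMap.range (LinearMap.mulRight ℂ (youngSymmetrizer R))

lemma mul_mem_specht {n : ℕ} (R : Diagram n) (a : GroupAlg n) {x : GroupAlg n}
    (hx : x ∈ specht R) : a * x ∈ specht R := by
  obtain ⟨y, rfl⟩ := hx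
  exact ⟨a * y, by simp [mul_assoc]⟩

/-- The irreducible representation of `S_n` labelled by `R`: left multiplication on the Specht
module. -/
def irrep {n : ℕ} (R : Diagram n) : Representation ℂ (Equiv.Perm (Fin n)) (specht R) where
  toFun σ := (LinearMap.mulLeft ℂ (perm σ)).restrict fun _ hx => mul_mem_specht R (perm σ) hx
  map_one' := by ext x; simp [perm]
  map_mul' σ τ := by
    refine LinearMap.ext fun x => Subtype.ext ?_
    simp [perm, LinearMap.restrict_apply, - MonoidAlgebra.of_apply]

/-- The dimension `d(R)`. -/
def dim {n : ℕ} (R : Diagram n) : ℕ := Module.finrank ℂ (specht R)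

/-- The normalized character `χ_R(T_k) / d(R)`. -/
def normalizedCharacter {n : ℕ} (R : Diagram n) (k : ℕ) : ℂ :=
  (∑ σ ∈ cycleClass n k, (irrep R).character σ) / (dim R : ℂ)

/-! ### The Fourier subspaces of `𝒦(n)` -/

/-- The element
`κ ∑_{σ₁, σ₂} tr_{R₁ ⊗ R₂}((D^{R₁}(σ₁) ⊗ D^{R₂}(σ₂)) ∘ f ∘ g) σ₁ ⊗ σ₂`,
`κ = d(R₁) d(R₂) / (n!)²`, for `S_n`-equivariant `f : R₃ → R₁ ⊗ R₂` and `g : R₁ ⊗ R₂ → R₃`.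
The Fourier basis element `Q^{R₁,R₂,R₃}_{τ₁,τ₂}` is the case where `f` is the embedding with matrix
the Clebsch-Gordan coefficients of the copy `τ₂` of `R₃` in `R₁ ⊗ R₂`, and `g` the transpose of
the one for `τ₁`. -/
def fourierElement {n : ℕ} (R : Fin 3 → Diagram n)
    (f : (irrep (R 2)).IntertwiningMap ((irrep (R 0)).tprod (irrep (R 1))))
    (g : ((irrep (R 0)).tprod (irrep (R 1))).IntertwiningMap (irrep (R 2))) : GroupAlg2 n :=
  ((dim (R 0) : ℂ) * (dim (R 1) : ℂ) / ((n.factorial : ℂ) ^ 2)) •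
    ∑ σ₁ : Equiv.Perm (Fin n), ∑ σ₂ : Equiv.Perm (Fin n),
      LinearMap.trace ℂ _ (TensorProduct.map (irrep (R 0) σ₁) (irrep (R 1) σ₂) ∘ₗ
        f.toLinearMap ∘ₗ g.toLinearMap) • permPair σ₁ σ₂

lemma fourierElement_mem {n : ℕ} (R : Fin 3 → Diagram n)
    (f : (irrep (R 2)).IntertwiningMap ((irrep (R 0)).tprod (irrep (R 1))))
    (g : ((irrep (R 0)).tprod (irrep (R 1))).IntertwiningMap (irrep (R 2))) :
    fourierElement R f g ∈ ribbonAlgebra n := by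
  rw [mem_ribbonAlgebra_iff]
  intro γ
  simp only [fourierElement, mul_smul_comm, smul_mul_assoc, Finset.mul_sum, Finset.sum_mul,
    permPair_mul]
  congr 1
  refine Fintype.sum_equiv (MulAut.conj γ).toEquiv _ _ fun σ₁ => ?_
  refine Fintype.sum_equiv (MulAut.conj γ).toEquiv _ _ fun σ₂ => ?_
  have hc : TensorProduct.map (irrep (R 0) (γ * σ₁ * γ⁻¹)) (irrep (R 1) (γ * σ₂ * γ⁻¹)) =
      ((irrep (R 0)).tprod (irrep (R 1)) γ ∘ₗ
        TensorProduct.map (irrep (R 0) σ₁) (irrep (R 1) σ₂)) ∘ₗ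
        (irrep (R 0)).tprod (irrep (R 1)) γ⁻¹ := by
    simp only [map_mul, Representation.tprod_apply, ← TensorProduct.map_comp]
    rfl
  have hfg : ∀ x, f.toLinearMap (g.toLinearMap ((irrep (R 0)).tprod (irrep (R 1)) γ x)) =
      (irrep (R 0)).tprod (irrep (R 1)) γ (f.toLinearMap (g.toLinearMap x)) := fun x => by
    have h1 := LinearMap.congr_fun (g.isIntertwining' γ) x
    have h2 := LinearMap.congr_fun (f.isIntertwining' γ) (g.toLinearMap x)
    simp only [LinearMap.comp_apply] at h1 h2
    rw [h1, h2]
  congr 1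
  · simp only [MulEquiv.toEquiv_eq_coe, EquivLike.coe_coe, MulAut.conj_apply]
    rw [hc, LinearMap.comp_assoc, LinearMap.comp_assoc]
    refine Eq.trans ?_ (LinearMap.trace_mul_comm ℂ _ ((irrep (R 0)).tprod (irrep (R 1)) γ))
    congr 1
    refine LinearMap.ext fun x => ?_
    simp only [LinearMap.comp_apply, Module.End.mul_apply]
    rw [hfg, Representation.inv_self_apply]
  · simp [mul_assoc]

/-- The Fourier subspace of the triple `(R₁, R₂, R₃)` in `𝒦(n)`: the span of the Fourier basis
elements `Q^{R₁,R₂,R₃}_{τ₁,τ₂}`. -/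
def fourierSubspace {n : ℕ} (R : Fin 3 → Diagram n) : Submodule ℂ (ribbonAlgebra n) :=
  Submodule.span ℂ {x | ∃ f g, x = ⟨fourierElement R f g, fourierElement_mem R f g⟩}

end RibbonGraph

end

noncomputable section

namespace RibbonGraph

variable {n : ℕ}

/-! ### Orbit sums in the group algebra -/

/-! Eigenvalues. Multiplying the Fourier sum of an endomorphism `F` of `R₁ ⊗ R₂` by `γ ⊗ δ` replaces
`F` by `F ∘ (D(γ⁻¹) ⊗ D(δ⁻¹))`, by reindexing and cyclicity of the trace
(`permPair_mul_traceElement`). Summed over a conjugacy class closed under inversion, this is a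
central element acting on one factor, or on `R₃` once it is moved through the intertwiner `g`;
either way it is a scalar.

Separation. Each `R i` is recovered from its own list of eigenvalues, in three moves. (1) The centre
of `𝒦(n)` is generated by the cycle sums with `k ≤ n` (`generatesCentre_self`), so the infimum
defining `kStar` is attained. For this, the endomorphisms of `ℂ(S_n) ⊗ ℂ(S_n)` commuting with the
left diagonal `S_n` and the right `S_n × S_n` are the left multiplications by `𝒦(n)`. By density a
central element of `𝒦(n)` acts through these groups, and averaging turns it into a combination of
products of class sums. Class sums are polynomials in cycle sums, by induction on the support. (2)
If the `T_k^{(i)}` with `k ≤ K` generate the centre of `𝒦(n)`, the `T_k` with `k ≤ K` already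
generate all class sums of `ℂ(S_n)`: let `σ ⊗ τ` act on the centre of `ℂ(S_n)` by `x ↦ σ x τ⁻¹`. The
first two families act as `T_k` and the third by scalars (`conjSum_mem_adjoin_of_generatesCentre`).
(3) Equal eigenvalues then make every class sum act by one scalar on the Young symmetrizers of two
diagrams. If these differ, the averaged symmetrizer `z` of one kills the other, hence kills its own
symmetrizer, so `z² = 0`. But its identity coefficient is `n!`, while nilpotents have identity
coefficient zero (`eq_of_normalizedCharacter_eq`). -/

lemma perm_mul (σ τ : Equiv.Perm (Fin n)) : perm (σ * τ) = perm σ * perm τ := by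
  simp only [perm, map_mul]

lemma perm_one : perm (1 : Equiv.Perm (Fin n)) = 1 := by
  simp only [perm, map_one]

/-- Two linear maps on the group algebra agreeing on permutations are equal. -/
lemma linearMap_ext_perm {M : Type*} [AddCommMonoid M] [Module ℂ M] {f g : GroupAlg n →ₗ[ℂ] M}
    (h : ∀ σ, f (perm σ) = g (perm σ)) : f = g := by
  refine MonoidAlgebra.lhom_ext' fun σ => LinearMap.ext_ring ?_
  exact h σ

/-- The conjugation average, up to the factor `n!`. -/
def conjTotal (n : ℕ) : GroupAlg n →ₗ[ℂ] GroupAlg n :=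
  ∑ g : Equiv.Perm (Fin n), LinearMap.mulLeft ℂ (perm g) ∘ₗ LinearMap.mulRight ℂ (perm g⁻¹)

lemma conjTotal_apply (x : GroupAlg n) :
    conjTotal n x = ∑ g : Equiv.Perm (Fin n), perm g * (x * perm g⁻¹) := by
  simp [conjTotal]

/-- The sum of all the conjugates of a permutation, with multiplicities. -/
def conjSum (σ : Equiv.Perm (Fin n)) : GroupAlg n :=
  ∑ g : Equiv.Perm (Fin n), perm (g * σ * g⁻¹)

lemma conjTotal_perm (σ : Equiv.Perm (Fin n)) : conjTotal n (perm σ) = conjSum σ := by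
  simp only [conjTotal_apply, conjSum, perm_mul, mul_assoc]

lemma conjTotal_of_comm {x : GroupAlg n} (hx : ∀ g, perm g * x = x * perm g) :
    conjTotal n x = (n.factorial : ℂ) • x := by
  have : ∀ g : Equiv.Perm (Fin n), perm g * (x * perm g⁻¹) = x := fun g => by
    rw [← mul_assoc, hx, mul_assoc, ← perm_mul, mul_inv_cancel, perm_one, mul_one]
  rw [conjTotal_apply]
  simp only [this, Finset.sum_const, Finset.card_univ, Fintype.card_perm, Fintype.card_fin]
  rw [Nat.cast_smul_eq_nsmul]

lemma perm_mul_conjTotal (h : Equiv.Perm (Fin n)) (x : GroupAlg n) :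
    perm h * conjTotal n x = conjTotal n x * perm h := by
  rw [conjTotal_apply, Finset.mul_sum, Finset.sum_mul]
  refine Fintype.sum_equiv (Equiv.mulLeft h) _ _ fun g => ?_
  simp only [Equiv.coe_mulLeft, mul_inv_rev, mul_assoc, ← perm_mul, inv_mul_cancel, mul_one]
  simp only [perm_mul, mul_assoc]

lemma comm_of_perm_comm {x : GroupAlg n} (hx : ∀ g, perm g * x = x * perm g) (y : GroupAlg n) :
    y * x = x * y :=
  LinearMap.congr_fun (linearMap_ext_perm (f := LinearMap.mulRight ℂ x)
    (g := LinearMap.mulLeft ℂ x) hx) y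

lemma conjTotal_comm (x y : GroupAlg n) : y * conjTotal n x = conjTotal n x * y :=
  comm_of_perm_comm (fun g => perm_mul_conjTotal g x) y

lemma conjSum_comm (σ : Equiv.Perm (Fin n)) (y : GroupAlg n) : y * conjSum σ = conjSum σ * y := by
  rw [← conjTotal_perm, conjTotal_comm]

lemma conjSum_one : conjSum (1 : Equiv.Perm (Fin n)) = (n.factorial : ℂ) • 1 := by
  rw [← conjTotal_perm, perm_one, conjTotal_of_comm]
  simp

lemma conjSum_of_isConj {σ τ : Equiv.Perm (Fin n)} (h : IsConj σ τ) : conjSum σ = conjSum τ := by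
  obtain ⟨c, rfl⟩ := isConj_iff.1 h
  refine (Fintype.sum_equiv (Equiv.mulRight c) _ _ fun g => ?_).symm
  simp [mul_assoc]

/-- Since `conjSum τ` is central, the product is the conjugation average of `σ * conjSum τ`, which
can be expanded term by term. -/
lemma conjSum_mul_conjSum (σ τ : Equiv.Perm (Fin n)) :
    conjSum σ * conjSum τ = ∑ h : Equiv.Perm (Fin n), conjSum (σ * (h * τ * h⁻¹)) := by
  have h1 : conjTotal n (perm σ * conjSum τ) = conjSum σ * conjSum τ := by
    rw [conjTotal_apply, ← conjTotal_perm σ, conjTotal_apply, Finset.sum_mul]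
    refine Finset.sum_congr rfl fun g _ => ?_
    simp only [mul_assoc, ← conjSum_comm τ]
  rw [← h1]
  conv_lhs => rw [conjSum, Finset.mul_sum, map_sum]
  refine Finset.sum_congr rfl fun h _ => ?_
  rw [← perm_mul, conjTotal_perm]

lemma cycleSum_comm (k : ℕ) (y : GroupAlg n) : y * cycleSum n k = cycleSum n k * y := by
  refine comm_of_perm_comm (fun g => ?_) y
  conv_rhs => rw [cycleSum, ← sum_cycleClass_conj (fun σ => perm σ) g, Finset.sum_mul]
  rw [cycleSum, Finset.mul_sum]
  refine Finset.sum_congr rfl fun σ _ => ?_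
  simp only [← perm_mul, inv_mul_cancel_right]

lemma isConj_of_mem_cycleClass {k : ℕ} {σ τ : Equiv.Perm (Fin n)} (hσ : σ ∈ cycleClass n k)
    (hτ : τ ∈ cycleClass n k) : IsConj σ τ := by
  rw [Equiv.Perm.partition_eq_of_isConj, Nat.Partition.ext_iff]
  simp only [cycleClass, Finset.mem_filter] at hσ hτ
  rw [hσ.2, hτ.2]

/-- Both sides compute `conjTotal` of the cycle sum: it is central, and its terms are all conjugate
to `σ`. -/
lemma factorial_smul_cycleSum {k : ℕ} {σ : Equiv.Perm (Fin n)} (hσ : σ ∈ cycleClass n k) :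
    (n.factorial : ℂ) • cycleSum n k = ((cycleClass n k).card : ℂ) • conjSum σ := by
  rw [← conjTotal_of_comm (fun g => cycleSum_comm k (perm g)), cycleSum, map_sum,
    Finset.sum_congr rfl fun τ hτ => by
      rw [conjTotal_perm, conjSum_of_isConj (isConj_of_mem_cycleClass hτ hσ)],
    Finset.sum_const, Nat.cast_smul_eq_nsmul]

lemma mem_cycleClass_of_isCycle {σ : Equiv.Perm (Fin n)} (hσ : σ.IsCycle) :
    σ ∈ cycleClass n σ.support.card := by
  simp only [cycleClass, Finset.mem_filter, Finset.mem_univ, true_and]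
  rw [Equiv.Perm.parts_partition, hσ.cycleType, Fintype.card_fin]
  congr!

lemma cycleClass_one (hn : 1 ≤ n) : cycleClass n 1 = {1} := by
  have h1 : (1 : Equiv.Perm (Fin n)) ∈ cycleClass n 1 := by
    simp only [cycleClass, Finset.mem_filter, Finset.mem_univ, true_and]
    rw [Equiv.Perm.parts_partition, Equiv.Perm.cycleType_one, ← Multiset.replicate_succ,
      Nat.sub_add_cancel hn]
    simp
  refine Finset.eq_singleton_iff_unique_mem.2 ⟨h1, fun σ hσ => ?_⟩
  have := isConj_of_mem_cycleClass h1 hσ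
  exact isConj_one_right.1 this

lemma cycleSum_one (hn : 1 ≤ n) : cycleSum n 1 = 1 := by
  rw [cycleSum, cycleClass_one hn, Finset.sum_singleton, perm_one]

lemma inv_mem_cycleClass {k : ℕ} {σ : Equiv.Perm (Fin n)} :
    σ⁻¹ ∈ cycleClass n k ↔ σ ∈ cycleClass n k := by
  have h : σ⁻¹.partition = σ.partition := by
    rw [← Equiv.Perm.partition_eq_of_isConj, Equiv.Perm.isConj_iff_cycleType_eq,
      Equiv.Perm.cycleType_inv]
  simp [cycleClass, h]

lemma sum_cycleClass_inv {k : ℕ} {M : Type*} [AddCommMonoid M] (f : Equiv.Perm (Fin n) → M) :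
    ∑ σ ∈ cycleClass n k, f σ⁻¹ = ∑ σ ∈ cycleClass n k, f σ :=
  Finset.sum_equiv (Equiv.inv _) (fun σ => by simp [inv_mem_cycleClass]) (fun σ _ => by simp)

/-! ### The sums over cycles generate the centre of the group algebra -/

lemma eq_one_or_isCycle_or_mul (σ : Equiv.Perm (Fin n)) : σ = 1 ∨ σ.IsCycle ∨
    ∃ c τ : Equiv.Perm (Fin n), c.Disjoint τ ∧ c ≠ 1 ∧ τ ≠ 1 ∧ σ = c * τ := by
  induction σ using Equiv.Perm.cycle_induction_on with
  | base_one => exact Or.inl rfl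
  | base_cycles σ hσ => exact Or.inr (Or.inl hσ)
  | induction_disjoint σ τ hd hc _ _ =>
    right
    by_cases hτ : τ = 1
    · left; simpa [hτ] using hc
    · exact Or.inr ⟨σ, τ, hd, hc.ne_one, hτ, rfl⟩

/-- Strong induction on the size of the support. Splitting off a cycle `c` from `σ = c * τ`, the
product of the two class sums is a positive multiple of the class sum of `σ` plus class sums of
smaller support. -/
theorem conjSum_mem_adjoin_cycleSum (σ : Equiv.Perm (Fin n)) :
    conjSum σ ∈ Algebra.adjoin ℂ {x | ∃ k ∈ Finset.Icc 1 n, x = cycleSum n k} := by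
  set S := Algebra.adjoin ℂ {x | ∃ k ∈ Finset.Icc 1 n, x = cycleSum n k}
  induction hm : σ.support.card using Nat.strong_induction_on generalizing σ with
  | _ m ih =>
  subst hm
  rcases eq_one_or_isCycle_or_mul σ with rfl | hσ | ⟨c, τ, hd, hc, hτ, rfl⟩
  · rw [conjSum_one]
    exact S.smul_mem S.one_mem _
  · have hmem := mem_cycleClass_of_isCycle hσ
    have h0 : ((cycleClass n σ.support.card).card : ℂ) ≠ 0 := by
      exact_mod_cast (Finset.card_pos.2 ⟨σ, hmem⟩).ne'
    rw [← inv_smul_smul₀ h0 (conjSum σ), ← factorial_smul_cycleSum hmem]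
    refine S.smul_mem (S.smul_mem (Algebra.subset_adjoin ⟨_, ?_, rfl⟩) _) _
    rw [Finset.mem_Icc]
    refine ⟨hσ.two_le_card_support.trans' one_le_two, ?_⟩
    simpa using Finset.card_le_univ σ.support
  · have hcard := hd.card_support_mul
    have hc0 : 0 < c.support.card := Finset.card_pos.2 (by
      rwa [Finset.nonempty_iff_ne_empty, Ne, Equiv.Perm.support_eq_empty_iff])
    have hτ0 : 0 < τ.support.card := Finset.card_pos.2 (by
      rwa [Finset.nonempty_iff_ne_empty, Ne, Equiv.Perm.support_eq_empty_iff])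
    have hmul := S.mul_mem (ih _ (by omega) c rfl) (ih _ (by omega) τ rfl)
    rw [conjSum_mul_conjSum] at hmul
    classical
    rw [← Finset.sum_filter_add_sum_filter_not _
      (fun h : Equiv.Perm (Fin n) => c.Disjoint (h * τ * h⁻¹))] at hmul
    -- When the supports overlap, their union, and so the support of the product, is strictly
    -- smaller than that of `c * τ`.
    have h2 : ∑ h with ¬ c.Disjoint (h * τ * h⁻¹), conjSum (c * (h * τ * h⁻¹)) ∈ S := by
      refine S.sum_mem fun h hh => ih _ ?_ _ rfl
      rw [Finset.mem_filter] at hh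
      have h3 : (c * (h * τ * h⁻¹)).support.card ≤ (c.support ∪ (h * τ * h⁻¹).support).card :=
        Finset.card_le_card (Equiv.Perm.support_mul_le _ _)
      have h4 := Finset.card_union_add_card_inter c.support (h * τ * h⁻¹).support
      have h5 : 0 < (c.support ∩ (h * τ * h⁻¹).support).card := by
        rw [Finset.card_pos, ← Finset.not_disjoint_iff_nonempty_inter,
          ← Equiv.Perm.disjoint_iff_disjoint_support]
        exact hh.2
      have h6 : (h * τ * h⁻¹).support.card = τ.support.card := Equiv.Perm.card_support_conj
      omega
    have h1 := (S.toSubmodule.add_mem_iff_left h2).1 hmul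
    -- The disjoint terms are all conjugate to `c * τ`; their number is nonzero because `h = 1` is
    -- one of them.
    rw [Finset.sum_congr rfl fun h hh => conjSum_of_isConj (Equiv.Perm.Disjoint.isConj_mul
      (IsConj.refl c) (isConj_iff.2 ⟨h⁻¹, by group⟩) (Finset.mem_filter.1 hh).2 hd),
      Finset.sum_const, ← Nat.cast_smul_eq_nsmul ℂ] at h1
    refine (S.toSubmodule.smul_mem_iff ?_).1 h1
    exact_mod_cast (Finset.card_pos.2 ⟨1, Finset.mem_filter.2 ⟨Finset.mem_univ _,
      by simpa using hd⟩⟩).ne'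

/-! ### The centre of the algebra of ribbon graphs -/

/-- The diagonal embedding of the group algebra. -/
def diagonal (n : ℕ) : GroupAlg n →ₐ[ℂ] GroupAlg2 n :=
  MonoidAlgebra.lift ℂ _ _
    { toFun := fun σ => permPair σ σ
      map_one' := permPair_one
      map_mul' := fun σ τ => (permPair_mul σ σ τ τ).symm }

lemma diagonal_perm (σ : Equiv.Perm (Fin n)) : diagonal n (perm σ) = permPair σ σ := by
  simp [diagonal, perm]

/-- Two linear maps on `ℂ(S_n) ⊗ ℂ(S_n)` agreeing on pairs of permutations are equal. -/
lemma linearMap_ext_permPair {M : Type*} [AddCommMonoid M] [Module ℂ M]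
    {f g : GroupAlg2 n →ₗ[ℂ] M} (h : ∀ σ τ, f (permPair σ τ) = g (permPair σ τ)) : f = g :=
  LinearMap.ext_on (s := Set.range fun τ : Equiv.Perm (Fin n) × Equiv.Perm (Fin n) =>
    permPair τ.1 τ.2) (Submodule.eq_top_iff'.2 fun x => span_permPair n x)
    (by rintro _ ⟨τ, rfl⟩; exact h _ _)

/-- The diagonal `S_n` acting on the left and `S_n × S_n` acting on the right of
`ℂ(S_n) ⊗ ℂ(S_n)`. -/
def bimoduleRep (n : ℕ) : Representation ℂ
    (Equiv.Perm (Fin n) × Equiv.Perm (Fin n) × Equiv.Perm (Fin n)) (GroupAlg2 n) where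
  toFun γ := LinearMap.mulLeft ℂ (permPair γ.1 γ.1) ∘ₗ
    LinearMap.mulRight ℂ (permPair γ.2.1⁻¹ γ.2.2⁻¹)
  map_one' := by
    refine LinearMap.ext fun x => ?_
    simp [permPair_one]
  map_mul' γ δ := by
    refine LinearMap.ext fun x => ?_
    simp [mul_assoc, ← permPair_mul]

lemma bimoduleRep_apply (γ : Equiv.Perm (Fin n) × Equiv.Perm (Fin n) × Equiv.Perm (Fin n))
    (x : GroupAlg2 n) :
    bimoduleRep n γ x = permPair γ.1 γ.1 * (x * permPair γ.2.1⁻¹ γ.2.2⁻¹) := rfl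

/-- Commuting with the right action forces left multiplication by `w = ψ 1`, as `1` generates under
it; commuting with the left diagonal action puts `w` in `𝒦(n)`. -/
lemma end_bimoduleRep (φ : Module.End (MonoidAlgebra ℂ (Equiv.Perm (Fin n) × Equiv.Perm (Fin n) ×
      Equiv.Perm (Fin n))) (bimoduleRep n).asModule) :
    ∃ w ∈ ribbonAlgebra n, ∀ x : GroupAlg2 n,
      (bimoduleRep n).asModuleEquiv (φ ((bimoduleRep n).asModuleEquiv.symm x)) = w * x := by
  set e := (bimoduleRep n).asModuleEquiv
  let ψ : GroupAlg2 n →ₗ[ℂ] GroupAlg2 n :=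
    e.toLinearMap ∘ₗ φ.restrictScalars ℂ ∘ₗ e.symm.toLinearMap
  have hψ : ∀ γ x, ψ (bimoduleRep n γ x) = bimoduleRep n γ (ψ x) := by
    intro γ x
    change e (φ (e.symm _)) = bimoduleRep n γ (e (φ (e.symm x)))
    rw [Representation.asModuleEquiv_symm_map_rho, map_smul,
      Representation.asModuleEquiv_map_smul]
    rw [Representation.asAlgebraHom_of]
  have h1 : ∀ x, ψ x = ψ 1 * x := by
    refine fun x => LinearMap.congr_fun (linearMap_ext_permPair (f := ψ)
      (g := LinearMap.mulLeft ℂ (ψ 1)) fun σ τ => ?_) x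
    have := hψ (1, σ⁻¹, τ⁻¹) 1
    simpa [bimoduleRep_apply, permPair_one] using this
  refine ⟨ψ 1, (mem_ribbonAlgebra_iff _).2 fun γ => ?_, h1⟩
  have := hψ (γ, 1, 1) 1
  simp only [bimoduleRep_apply, inv_one, permPair_one, mul_one] at this
  rw [← this, h1]

/-- By the density theorem, multiplication by a central element of `𝒦(n)` is a combination of
the operators `x ↦ (h ⊗ h) x (g₁ ⊗ g₂)`. -/
lemma exists_bimodule_of_mem_center {z : ribbonAlgebra n}
    (hz : z ∈ Subalgebra.center ℂ (ribbonAlgebra n)) :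
    ∃ r, ∀ σ τ : Equiv.Perm (Fin n),
      (z : GroupAlg2 n) * permPair σ τ = (bimoduleRep n).asAlgebraHom r (permPair σ τ) := by
  classical
  set e := (bimoduleRep n).asModuleEquiv
  let R := MonoidAlgebra ℂ (Equiv.Perm (Fin n) × Equiv.Perm (Fin n) × Equiv.Perm (Fin n))
  -- Multiplication by `z` is linear over the endomorphism ring because that ring consists of
  -- multiplications by elements of `𝒦(n)`, with which `z` commutes.
  let f : Module.End (Module.End R (bimoduleRep n).asModule) (bimoduleRep n).asModule :=
    { toFun := fun x => e.symm (z * e x)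
      map_add' := fun x y => by simp [mul_add]
      map_smul' := fun φ x => by
        obtain ⟨w, hw, hφ⟩ := end_bimoduleRep φ
        have hzw : (z : GroupAlg2 n) * w = w * z :=
          congrArg Subtype.val ((Subalgebra.mem_center_iff.1 hz ⟨w, hw⟩).symm)
        apply e.injective
        have h1 := hφ (e x)
        have h2 := hφ (z * e x)
        simp only [e, LinearEquiv.symm_apply_apply] at h1 h2
        simp only [e, LinearEquiv.apply_symm_apply, Module.End.smul_def, RingHom.id_apply, h1, h2,
          ← mul_assoc, hzw] }
  -- Density is applied on all pairs of permutations at once; they form a finite spanning set.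
  obtain ⟨r, hr⟩ := jacobson_density f (Finset.univ.image
    fun τ : Equiv.Perm (Fin n) × Equiv.Perm (Fin n) => e.symm (permPair τ.1 τ.2))
  refine ⟨r, fun σ τ => ?_⟩
  have h := hr (e.symm (permPair σ τ)) (Finset.mem_image.2 ⟨(σ, τ), Finset.mem_univ _, rfl⟩)
  have h' := congrArg e h
  rw [Representation.asModuleEquiv_map_smul] at h'
  simpa [f, e] using h'

lemma conjSum_tmul_conjSum (σ τ : Equiv.Perm (Fin n)) :
    ∑ a : Equiv.Perm (Fin n), ∑ b : Equiv.Perm (Fin n),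
      permPair (a * σ * a⁻¹) (b * τ * b⁻¹) = conjSum σ ⊗ₜ[ℂ] conjSum τ := by
  rw [conjSum, TensorProduct.sum_tmul]
  refine Finset.sum_congr rfl fun a _ => ?_
  rw [conjSum, TensorProduct.tmul_sum]
  rfl

lemma conjSum_tmul_conjSum_comm (σ τ : Equiv.Perm (Fin n)) (x : GroupAlg2 n) :
    x * (conjSum σ ⊗ₜ[ℂ] conjSum τ) = (conjSum σ ⊗ₜ[ℂ] conjSum τ) * x := by
  induction x using TensorProduct.induction_on with
  | zero => simp
  | add x y hx hy => rw [add_mul, mul_add, hx, hy]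
  | tmul a b => simp only [Algebra.TensorProduct.tmul_mul_tmul, conjSum_comm]

lemma diagonal_conjSum (σ : Equiv.Perm (Fin n)) : diagonal n (conjSum σ) =
    ∑ l : Equiv.Perm (Fin n), permPair (l * σ * l⁻¹) (l * σ * l⁻¹) := by
  simp only [conjSum, map_sum, diagonal_perm]

/-- The sums over `a` and `b` produce a central tensor of class sums; the sum over `l` then only
conjugates `h`. -/
lemma sum_bimoduleRep (h σ τ : Equiv.Perm (Fin n)) :
    ∑ l : Equiv.Perm (Fin n), ∑ a : Equiv.Perm (Fin n), ∑ b : Equiv.Perm (Fin n),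
      permPair l l * bimoduleRep n (h, σ, τ) (permPair a b) * permPair a⁻¹ b⁻¹ *
        permPair l⁻¹ l⁻¹ =
      diagonal n (conjSum h) * (conjSum σ⁻¹ ⊗ₜ[ℂ] conjSum τ⁻¹) := by
  rw [diagonal_conjSum, Finset.sum_mul]
  refine Finset.sum_congr rfl fun l _ => ?_
  have : permPair (l * h * l⁻¹) (l * h * l⁻¹) * (conjSum σ⁻¹ ⊗ₜ[ℂ] conjSum τ⁻¹) =
      permPair (l * h) (l * h) * (conjSum σ⁻¹ ⊗ₜ[ℂ] conjSum τ⁻¹) * permPair l⁻¹ l⁻¹ := by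
    rw [mul_assoc (permPair (l * h) (l * h)), ← conjSum_tmul_conjSum_comm, ← mul_assoc,
      permPair_mul]
  rw [this, ← conjSum_tmul_conjSum]
  simp only [Finset.mul_sum, Finset.sum_mul, bimoduleRep_apply, permPair_mul, mul_assoc]

lemma sum_bimoduleRep_asAlgebraHom_mem {S : Subalgebra ℂ (GroupAlg2 n)}
    (hd : ∀ σ, diagonal n (conjSum σ) ∈ S) (ht : ∀ σ τ, conjSum σ ⊗ₜ[ℂ] conjSum τ ∈ S) (r) :
    ∑ l : Equiv.Perm (Fin n), ∑ a : Equiv.Perm (Fin n), ∑ b : Equiv.Perm (Fin n),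
      permPair l l * (bimoduleRep n).asAlgebraHom r (permPair a b) * permPair a⁻¹ b⁻¹ *
        permPair l⁻¹ l⁻¹ ∈ S := by
  induction r using MonoidAlgebra.induction_on with
  | of γ =>
    rw [Representation.asAlgebraHom_of, sum_bimoduleRep γ.1 γ.2.1 γ.2.2]
    exact S.mul_mem (hd _) (ht _ _)
  | add f g hf hg =>
    simp only [map_add, LinearMap.add_apply, mul_add, add_mul, Finset.sum_add_distrib]
    exact S.add_mem hf hg
  | smul c f hf =>
    simp only [map_smul, LinearMap.smul_apply, mul_smul_comm, smul_mul_assoc, ← Finset.smul_sum]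
    exact S.smul_mem hf c

/-- The triple sum of the previous lemmas is evaluated twice: through `r` it lies in `S`, and
through `z` every term equals `z`, giving `(n!)³ z`. -/
theorem mem_of_mem_center {S : Subalgebra ℂ (GroupAlg2 n)}
    (hd : ∀ σ, diagonal n (conjSum σ) ∈ S) (ht : ∀ σ τ, conjSum σ ⊗ₜ[ℂ] conjSum τ ∈ S)
    {z : ribbonAlgebra n} (hz : z ∈ Subalgebra.center ℂ (ribbonAlgebra n)) :
    (z : GroupAlg2 n) ∈ S := by
  obtain ⟨r, hr⟩ := exists_bimodule_of_mem_center hz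
  have h := sum_bimoduleRep_asAlgebraHom_mem hd ht r
  have hz' : ∀ l a b : Equiv.Perm (Fin n),
      permPair l l * (bimoduleRep n).asAlgebraHom r (permPair a b) * permPair a⁻¹ b⁻¹ *
        permPair l⁻¹ l⁻¹ = z := fun l a b => by
    rw [← hr, mul_assoc (permPair l l), mul_assoc (z : GroupAlg2 n), permPair_mul, mul_inv_cancel,
      mul_inv_cancel, permPair_one, mul_one, (mem_ribbonAlgebra_iff _).1 z.2, mul_assoc,
      permPair_mul, mul_inv_cancel, permPair_one, mul_one]
  simp only [hz', Finset.sum_const, ← Nat.cast_smul_eq_nsmul ℂ, smul_smul] at h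
  refine (S.toSubmodule.smul_mem_iff ?_).1 h
  simp [Fintype.card_perm, Nat.factorial_ne_zero]

/-! ### Centrality and generation by the reconnection elements -/

lemma reconnectionElement_two (k : ℕ) :
    reconnectionElement n 2 k = diagonal n (cycleSum n k) := by
  simp only [cycleSum, map_sum, diagonal_perm]
  rfl

lemma diagonal_commute {x : GroupAlg2 n} (hx : x ∈ ribbonAlgebra n) (y : GroupAlg n) :
    diagonal n y * x = x * diagonal n y :=
  LinearMap.congr_fun (linearMap_ext_perm
    (f := LinearMap.mulRight ℂ x ∘ₗ (diagonal n).toLinearMap)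
    (g := LinearMap.mulLeft ℂ x ∘ₗ (diagonal n).toLinearMap)
    fun γ => by simpa [diagonal_perm] using (mem_ribbonAlgebra_iff x).1 hx γ) y

lemma tmul_one_comm {a : GroupAlg n} (ha : ∀ y, y * a = a * y) (x : GroupAlg2 n) :
    x * (a ⊗ₜ[ℂ] 1) = (a ⊗ₜ[ℂ] 1) * x := by
  induction x using TensorProduct.induction_on with
  | zero => simp
  | add x y hx hy => rw [add_mul, mul_add, hx, hy]
  | tmul c b => simp only [Algebra.TensorProduct.tmul_mul_tmul, ha, one_mul, mul_one]

lemma one_tmul_comm {a : GroupAlg n} (ha : ∀ y, y * a = a * y) (x : GroupAlg2 n) :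
    x * (1 ⊗ₜ[ℂ] a) = (1 ⊗ₜ[ℂ] a) * x := by
  induction x using TensorProduct.induction_on with
  | zero => simp
  | add x y hx hy => rw [add_mul, mul_add, hx, hy]
  | tmul c b => simp only [Algebra.TensorProduct.tmul_mul_tmul, ha, one_mul, mul_one]

lemma reconnection_mem_center (i : Fin 3) (k : ℕ) :
    reconnection n i k ∈ Subalgebra.center ℂ (ribbonAlgebra n) := by
  rw [Subalgebra.mem_center_iff]
  rintro ⟨x, hx⟩
  refine Subtype.ext ?_
  change x * reconnectionElement n i k = reconnectionElement n i k * x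
  fin_cases i
  · exact tmul_one_comm (cycleSum_comm k) x
  · exact one_tmul_comm (cycleSum_comm k) x
  · exact (reconnectionElement_two (n := n) k).symm ▸ (diagonal_commute hx _).symm

/-- The reconnection operators with all cycle lengths up to `n` generate the centre. -/
theorem generatesCentre_self (n : ℕ) : GeneratesCentre n n := by
  refine le_antisymm (Algebra.adjoin_le ?_) fun z hz => ?_
  · rintro _ ⟨i, k, -, rfl⟩
    exact reconnection_mem_center i k
  set A := Algebra.adjoin ℂ {x : ribbonAlgebra n | ∃ i : Fin 3, ∃ k ∈ Finset.Icc 1 n,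
    x = reconnection n i k}
  have hA : ∀ i, ∀ k ∈ Finset.Icc 1 n, reconnectionElement n i k ∈ A.map (ribbonAlgebra n).val :=
    fun i k hk => ⟨reconnection n i k, Algebra.subset_adjoin ⟨i, k, hk, rfl⟩, rfl⟩
  have key : ∀ φ : GroupAlg n →ₐ[ℂ] GroupAlg2 n,
      (∀ k ∈ Finset.Icc 1 n, φ (cycleSum n k) ∈ A.map (ribbonAlgebra n).val) →
      ∀ σ, φ (conjSum σ) ∈ A.map (ribbonAlgebra n).val := fun φ hφ σ => by
    have h : Algebra.adjoin ℂ {x | ∃ k ∈ Finset.Icc 1 n, x = cycleSum n k} ≤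
        (A.map (ribbonAlgebra n).val).comap φ := Algebra.adjoin_le (by
      rintro _ ⟨k, hk, rfl⟩
      exact hφ k hk)
    exact h (conjSum_mem_adjoin_cycleSum σ)
  have hd := key (diagonal n) fun k hk => by
    rw [← reconnectionElement_two]; exact hA 2 k hk
  have h0 := key Algebra.TensorProduct.includeLeft fun k hk => hA 0 k hk
  have h1 := key Algebra.TensorProduct.includeRight fun k hk => hA 1 k hk
  have ht : ∀ σ τ, conjSum σ ⊗ₜ[ℂ] conjSum τ ∈ A.map (ribbonAlgebra n).val := fun σ τ => by
    simpa using Subalgebra.mul_mem _ (h0 σ) (h1 τ)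
  obtain ⟨y, hy, hyz⟩ := mem_of_mem_center hd ht hz
  rwa [← Subtype.ext (a1 := y) (a2 := z) hyz]

/-! ### From the centre of `𝒦(n)` to the centre of the group algebra -/

/-- `ℂ(S_n)` acting on itself by `(τ, x) ↦ x τ⁻¹`. -/
def rightAction (n : ℕ) : GroupAlg n →ₐ[ℂ] Module.End ℂ (GroupAlg n) :=
  MonoidAlgebra.lift ℂ _ _
    { toFun := fun τ => LinearMap.mulRight ℂ (perm τ⁻¹)
      map_one' := LinearMap.ext fun x => by simp [perm_one]
      map_mul' := fun σ τ => LinearMap.ext fun x => by simp [perm_mul, mul_assoc] }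

lemma rightAction_perm (τ : Equiv.Perm (Fin n)) :
    rightAction n (perm τ) = LinearMap.mulRight ℂ (perm τ⁻¹) := by
  rw [rightAction, perm, MonoidAlgebra.lift_of]
  rfl

lemma commute_lmul_rightAction (a b : GroupAlg n) :
    Commute (Algebra.lmul ℂ (GroupAlg n) a) (rightAction n b) :=
  LinearMap.congr_fun (linearMap_ext_perm
    (f := LinearMap.mulLeft ℂ (Algebra.lmul ℂ (GroupAlg n) a) ∘ₗ (rightAction n).toLinearMap)
    (g := LinearMap.mulRight ℂ (Algebra.lmul ℂ (GroupAlg n) a) ∘ₗ (rightAction n).toLinearMap)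
    fun γ => LinearMap.ext fun x => by
      simp only [LinearMap.comp_apply, AlgHom.toLinearMap_apply, rightAction_perm,
        LinearMap.mulLeft_apply, LinearMap.mulRight_apply, Module.End.mul_apply]
      exact (mul_assoc a x _).symm) b

/-- `ℂ(S_n) ⊗ ℂ(S_n)` acting on `ℂ(S_n)` by `(σ ⊗ τ) x = σ x τ⁻¹`. -/
def twoSidedAction (n : ℕ) : GroupAlg2 n →ₐ[ℂ] Module.End ℂ (GroupAlg n) :=
  Algebra.TensorProduct.lift (Algebra.lmul ℂ (GroupAlg n)) (rightAction n)
    commute_lmul_rightAction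

lemma twoSidedAction_tmul_perm (a x : GroupAlg n) (τ : Equiv.Perm (Fin n)) :
    twoSidedAction n (a ⊗ₜ[ℂ] perm τ) x = a * (x * perm τ⁻¹) := by
  rw [twoSidedAction, Algebra.TensorProduct.lift_tmul, rightAction_perm]
  rfl

lemma twoSidedAction_tmul_one (a x : GroupAlg n) :
    twoSidedAction n (a ⊗ₜ[ℂ] 1) x = a * x := by
  rw [← perm_one, twoSidedAction_tmul_perm, inv_one, perm_one, mul_one]

/-- The element `conjSum σ ⊗ 1` is central in `𝒦(n)`, hence a polynomial in the generators. On
central `x` each generator acts as multiplication by an element of `S` under the two-sided action;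
evaluating at `x = 1` recovers `conjSum σ`. -/
theorem conjSum_mem_adjoin_of_generatesCentre {K : ℕ} (hK : GeneratesCentre n K)
    (σ : Equiv.Perm (Fin n)) :
    conjSum σ ∈ Algebra.adjoin ℂ {x | ∃ k ∈ Finset.Icc 1 K, x = cycleSum n k} := by
  set S := Algebra.adjoin ℂ {x | ∃ k ∈ Finset.Icc 1 K, x = cycleSum n k}
  have hmem : conjSum σ ⊗ₜ[ℂ] 1 ∈ ribbonAlgebra n := by
    rw [mem_ribbonAlgebra_iff]
    exact fun γ => tmul_one_comm (conjSum_comm σ) _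
  have hc : (⟨_, hmem⟩ : ribbonAlgebra n) ∈ Subalgebra.center ℂ (ribbonAlgebra n) := by
    rw [Subalgebra.mem_center_iff]
    exact fun x => Subtype.ext (tmul_one_comm (conjSum_comm σ) _)
  rw [← hK] at hc
  -- The clause that `s * x` is again central is what lets the statement pass to products.
  have key : ∀ y ∈ Algebra.adjoin ℂ {x : ribbonAlgebra n | ∃ i : Fin 3, ∃ k ∈ Finset.Icc 1 K,
      x = reconnection n i k}, ∃ s ∈ S, ∀ x : GroupAlg n, (∀ a, a * x = x * a) →
        (∀ a, a * (s * x) = s * x * a) ∧ twoSidedAction n y x = s * x := by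
    intro y hy
    induction hy using Algebra.adjoin_induction with
    | mem y hy =>
      obtain ⟨i, k, hk, rfl⟩ := hy
      have hS : cycleSum n k ∈ S := Algebra.subset_adjoin ⟨k, hk, rfl⟩
      have hcomm : ∀ x : GroupAlg n, (∀ a, a * x = x * a) →
          ∀ a, a * (cycleSum n k * x) = cycleSum n k * x * a := fun x hx a => by
        rw [← mul_assoc, cycleSum_comm, mul_assoc, mul_assoc, hx]
      fin_cases i
      · refine ⟨_, hS, fun x hx => ⟨hcomm x hx, ?_⟩⟩
        change twoSidedAction n (cycleSum n k ⊗ₜ[ℂ] 1) x = _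
        exact twoSidedAction_tmul_one _ _
      · refine ⟨_, hS, fun x hx => ⟨hcomm x hx, ?_⟩⟩
        change twoSidedAction n (1 ⊗ₜ[ℂ] cycleSum n k) x = _
        -- The right action inverts permutations, harmlessly since a conjugacy class of `S_n` is
        -- closed under inversion.
        rw [cycleSum, TensorProduct.tmul_sum, map_sum, LinearMap.sum_apply, Finset.sum_mul,
          ← sum_cycleClass_inv]
        refine Finset.sum_congr rfl fun τ _ => ?_
        rw [twoSidedAction_tmul_perm, inv_inv, one_mul, hx]
      -- Conjugation fixes the central `x`, so the third family acts by the size of the class.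
      · refine ⟨algebraMap ℂ _ (cycleClass n k).card, S.algebraMap_mem _,
          fun x hx => ⟨fun a => ?_, ?_⟩⟩
        · rw [← Algebra.smul_def, mul_smul_comm, smul_mul_assoc, hx]
        · change twoSidedAction n (∑ σ ∈ cycleClass n k, permPair σ σ) x = _
          rw [← Algebra.smul_def, map_sum, LinearMap.sum_apply, Nat.cast_smul_eq_nsmul,
            ← Finset.sum_const]
          refine Finset.sum_congr rfl fun τ _ => ?_
          rw [permPair, twoSidedAction_tmul_perm, ← hx, ← mul_assoc, ← perm_mul, mul_inv_cancel,
            perm_one, one_mul]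
    | algebraMap c =>
      refine ⟨algebraMap ℂ _ c, S.algebraMap_mem _, fun x hx => ⟨fun a => ?_, ?_⟩⟩
      · rw [← Algebra.smul_def, mul_smul_comm, smul_mul_assoc, hx]
      · change twoSidedAction n (algebraMap ℂ _ c) x = _
        rw [AlgHom.commutes, ← Algebra.smul_def, Module.algebraMap_end_apply]
    | add y z _ _ hy hz =>
      obtain ⟨s, hs, h1⟩ := hy
      obtain ⟨t, ht, h2⟩ := hz
      refine ⟨s + t, S.add_mem hs ht, fun x hx => ⟨fun a => ?_, ?_⟩⟩
      · rw [add_mul, mul_add, add_mul, (h1 x hx).1, (h2 x hx).1]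
      · rw [Subalgebra.coe_add, map_add, LinearMap.add_apply, (h1 x hx).2, (h2 x hx).2, add_mul]
    | mul y z _ _ hy hz =>
      obtain ⟨s, hs, h1⟩ := hy
      obtain ⟨t, ht, h2⟩ := hz
      refine ⟨s * t, S.mul_mem hs ht, fun x hx => ⟨fun a => ?_, ?_⟩⟩
      · rw [mul_assoc s, (h1 _ (h2 x hx).1).1]
      · rw [Subalgebra.coe_mul, map_mul, Module.End.mul_apply, (h2 x hx).2,
          (h1 _ (h2 x hx).1).2, mul_assoc]
  obtain ⟨s, hs, h⟩ := key _ hc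
  have h1 := (h 1 (by simp)).2
  rw [twoSidedAction_tmul_one, mul_one, mul_one] at h1
  rwa [h1]

/-! ### Finite sets of boxes with the column lengths of a Young diagram -/

/-- Outside the intersection the two sets have equal size, but there the elements of `X` are at
least `k` and those of the initial segment are below `k`. -/
lemma sum_range_card_lt_sum {X : Finset ℕ} (hX : X ≠ Finset.range X.card) :
    ∑ i ∈ Finset.range X.card, i < ∑ i ∈ X, i := by
  set k := X.card with hk
  have hcard : (X \ Finset.range k).card = (Finset.range k \ X).card :=
    Finset.card_sdiff_comm (by simp [hk])
  have h1 : (X \ Finset.range k).card • k ≤ ∑ i ∈ X \ Finset.range k, i :=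
    Finset.card_nsmul_le_sum _ _ _ fun i hi => by simpa using (Finset.mem_sdiff.1 hi).2
  have hne : (Finset.range k \ X).Nonempty := by
    rw [Finset.sdiff_nonempty]
    exact fun h => hX (Finset.eq_of_subset_of_card_le h (by simp [hk])).symm
  have h2 : ∑ i ∈ Finset.range k \ X, i < ∑ _i ∈ Finset.range k \ X, k :=
    Finset.sum_lt_sum_of_nonempty hne fun i hi => by simpa using (Finset.mem_sdiff.1 hi).1
  rw [Finset.sum_const, ← hcard] at h2
  rw [← Finset.sum_inter_add_sum_sdiff X (Finset.range k),
    ← Finset.sum_inter_add_sum_sdiff (Finset.range k) X, Finset.inter_comm]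
  omega

/-- The sum of the row indices of the boxes. -/
def rowWeight (μ : YoungDiagram) : ℕ := ∑ s ∈ μ.cells, s.1

lemma sum_col (μ : YoungDiagram) (j : ℕ) :
    ∑ s ∈ μ.cells with s.2 = j, s.1 = ∑ i ∈ Finset.range (μ.colLen j), i := by
  change ∑ s ∈ μ.col j, s.1 = _
  rw [μ.col_eq_prod, Finset.sum_product]
  simp

lemma card_col (μ : YoungDiagram) (j : ℕ) :
    (μ.cells.filter fun s => s.2 = j).card = μ.colLen j :=
  μ.colLen_eq_card.symm

/-- Pushing each column up to an initial segment minimizes the sum of row indices, and only the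
pushed-up configuration attains the minimum. -/
lemma rowWeight_le_of_card_col {S : Finset (ℕ × ℕ)} {μ : YoungDiagram}
    (h : ∀ j, (S.filter fun s => s.2 = j).card = μ.colLen j) :
    rowWeight μ ≤ ∑ s ∈ S, s.1 ∧ (rowWeight μ = ∑ s ∈ S, s.1 → S = μ.cells) := by
  set t := S.image Prod.snd ∪ μ.cells.image Prod.snd with ht
  have hS : ∑ j ∈ t, ∑ s ∈ S with s.2 = j, s.1 = ∑ s ∈ S, s.1 :=
    Finset.sum_fiberwise_of_maps_to
      (fun s hs => Finset.mem_union_left _ (Finset.mem_image_of_mem _ hs)) _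
  have hμ : ∑ j ∈ t, ∑ s ∈ μ.cells with s.2 = j, s.1 = rowWeight μ :=
    Finset.sum_fiberwise_of_maps_to
      (fun s hs => Finset.mem_union_right _ (Finset.mem_image_of_mem _ hs)) _
  have hinj : ∀ j, Set.InjOn Prod.fst (S.filter fun s => s.2 = j : Set (ℕ × ℕ)) := by
    rintro j ⟨a, b⟩ hs ⟨c, d⟩ ht' rfl
    simp only [Finset.coe_filter, Set.mem_ofPred_eq] at hs ht'
    rw [hs.2, ht'.2]
  set X : ℕ → Finset ℕ := fun j => (S.filter fun s => s.2 = j).image Prod.fst with hXdef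
  have hXcard : ∀ j, (X j).card = μ.colLen j := fun j => by
    rw [hXdef, ← h j, Finset.card_image_of_injOn (hinj j)]
  have hXsum : ∀ j, ∑ s ∈ S with s.2 = j, s.1 = ∑ i ∈ X j, i := fun j => by
    rw [hXdef, Finset.sum_image (hinj j)]
  have hle : ∀ j ∈ t, ∑ s ∈ μ.cells with s.2 = j, s.1 ≤ ∑ s ∈ S with s.2 = j, s.1 := by
    intro j _
    rw [sum_col, hXsum, ← hXcard]
    by_cases hX : X j = Finset.range (X j).card
    · exact (congrArg (fun Y => ∑ i ∈ Y, i) hX).ge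
    · exact (sum_range_card_lt_sum hX).le
  refine ⟨hS ▸ hμ ▸ Finset.sum_le_sum hle, fun heq => ?_⟩
  rw [← hS, ← hμ, Finset.sum_eq_sum_iff_of_le hle] at heq
  refine Finset.eq_of_subset_of_card_le (fun s hs => ?_) ?_
  · have hj : s.2 ∈ t := Finset.mem_union_left _ (Finset.mem_image_of_mem _ hs)
    have h1 := heq _ hj
    rw [sum_col, hXsum, ← hXcard] at h1
    have hX : X s.2 = Finset.range (X s.2).card := by
      by_contra hX
      exact (sum_range_card_lt_sum hX).ne h1
    have hsX : s.1 ∈ X s.2 :=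
      Finset.mem_image_of_mem Prod.fst (Finset.mem_filter.2 ⟨hs, rfl⟩)
    rw [hX, hXcard, Finset.mem_range, ← YoungDiagram.mem_iff_lt_colLen] at hsX
    exact hsX
  · rw [Finset.card_eq_sum_card_fiberwise (f := Prod.snd) (t := t) (s := S)
      (fun s hs => Finset.mem_union_left _ (Finset.mem_image_of_mem _ hs)),
      Finset.card_eq_sum_card_fiberwise (f := Prod.snd) (t := t) (s := μ.cells)
      (fun s hs => Finset.mem_union_right _ (Finset.mem_image_of_mem _ hs))]
    exact Finset.sum_le_sum fun j _ => (card_col μ j).trans_le (h j).ge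

/-! ### Pairs of tableaux -/

lemma perm_apply_inv_self (σ : Equiv.Perm (Fin n)) (x : Fin n) : σ (σ⁻¹ x) = x :=
  σ.apply_symm_apply x

lemma perm_inv_apply_self (σ : Equiv.Perm (Fin n)) (x : Fin n) : σ⁻¹ (σ x) = x :=
  σ.symm_apply_apply x

/-- The pair of the row of `x` in the tableau of shape `R` and of its column in the translate by
`g` of the tableau of shape `R'`. -/
def rowCol (R R' : Diagram n) (g : Equiv.Perm (Fin n)) (x : Fin n) : ℕ × ℕ :=
  ((tableau R x).1.1, (tableau R' (g⁻¹ x)).1.2)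

lemma card_tableau_filter (R : Diagram n) (p : ℕ × ℕ → Prop) [DecidablePred p] :
    (Finset.univ.filter fun x => p (tableau R x).1).card = (R.1.cells.filter p).card := by
  refine Finset.card_bij (fun x _ => (tableau R x).1) (fun x hx => ?_) (fun x _ y _ h => ?_)
    fun s hs => ?_
  · exact Finset.mem_filter.2 ⟨(tableau R x).2, (Finset.mem_filter.1 hx).2⟩
  · exact (tableau R).injective (Subtype.ext h)
  · rw [Finset.mem_filter] at hs
    exact ⟨(tableau R).symm ⟨s, hs.1⟩, by simpa using hs.2, by simp⟩

lemma sum_tableau (R : Diagram n) : ∑ x, (tableau R x).1.1 = rowWeight R.1 := by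
  rw [rowWeight, ← Finset.sum_coe_sort R.1.cells fun s => s.1]
  exact Fintype.sum_equiv (tableau R) _ _ fun x => rfl

/-- The image has the column lengths of `R'` and, by injectivity, the row weight of `R`. Comparing
row weights here does the work usually done by the dominance order. -/
lemma image_rowCol {R R' : Diagram n} {g : Equiv.Perm (Fin n)}
    (hinj : Function.Injective (rowCol R R' g)) :
    rowWeight R'.1 ≤ rowWeight R.1 ∧
      (rowWeight R'.1 = rowWeight R.1 → Finset.univ.image (rowCol R R' g) = R'.1.cells) := by
  have hsum : ∑ s ∈ Finset.univ.image (rowCol R R' g), s.1 = rowWeight R.1 := by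
    rw [Finset.sum_image hinj.injOn]
    exact sum_tableau R
  rw [← hsum]
  refine rowWeight_le_of_card_col fun j => ?_
  rw [Finset.filter_image, Finset.card_image_of_injective _ hinj, ← card_col,
    ← card_tableau_filter R' (fun s => s.2 = j)]
  refine Finset.card_equiv g⁻¹ fun x => ?_
  rw [Finset.mem_filter_univ, Finset.mem_filter_univ]
  rfl

lemma eq_of_injective_rowCol {R R' : Diagram n} {g : Equiv.Perm (Fin n)}
    (hinj : Function.Injective (rowCol R R' g)) (hle : rowWeight R.1 ≤ rowWeight R'.1) :
    R = R' := by
  have himage := (image_rowCol hinj).2 (le_antisymm (image_rowCol hinj).1 hle)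
  have hrow : ∀ i, R.1.rowLen i = R'.1.rowLen i := fun i => by
    rw [YoungDiagram.rowLen_eq_card, YoungDiagram.rowLen_eq_card, YoungDiagram.row,
      YoungDiagram.row, ← himage, Finset.filter_image, Finset.card_image_of_injective _ hinj,
      ← card_tableau_filter]
    rfl
  refine Subtype.ext (YoungDiagram.ext (Finset.ext fun ⟨i, j⟩ => ?_))
  rw [YoungDiagram.mem_cells, YoungDiagram.mem_cells, YoungDiagram.mem_iff_lt_rowLen,
    YoungDiagram.mem_iff_lt_rowLen, hrow]

lemma mem_rowStabilizer {R : Diagram n} {σ : Equiv.Perm (Fin n)} :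
    σ ∈ rowStabilizer R ↔ ∀ x, (tableau R (σ x)).1.1 = (tableau R x).1.1 := by
  simp [rowStabilizer]

lemma mem_colStabilizer {R : Diagram n} {σ : Equiv.Perm (Fin n)} :
    σ ∈ colStabilizer R ↔ ∀ x, (tableau R (σ x)).1.2 = (tableau R x).1.2 := by
  simp [colStabilizer]

/-- The image is the diagram itself, so `p` can send `x` to the point whose row in the tableau and
column in its `g`-translate are those of the box of `x`. Then `p` preserves rows and `p⁻¹ * g`
preserves columns. -/
lemma exists_mul_of_injective_rowCol {R : Diagram n} {g : Equiv.Perm (Fin n)}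
    (hinj : Function.Injective (rowCol R R g)) :
    ∃ p ∈ rowStabilizer R, ∃ q ∈ colStabilizer R, g = p * q := by
  have himage := (image_rowCol hinj).2 rfl
  have hex : ∀ x, ∃ y, rowCol R R g y = (tableau R x).1 := fun x => by
    obtain ⟨y, -, hy⟩ := Finset.mem_image.1 (himage.ge (tableau R x).2)
    exact ⟨y, hy⟩
  choose f hf using hex
  have hfinj : Function.Injective f := fun x y hxy => by
    apply (tableau R).injective
    apply Subtype.ext
    rw [← hf, ← hf, hxy]
  let p : Equiv.Perm (Fin n) := Equiv.ofBijective f (Finite.injective_iff_bijective.1 hfinj)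
  have hp : ∀ x, p x = f x := fun x => rfl
  refine ⟨p, mem_rowStabilizer.2 fun x => ?_, p⁻¹ * g, mem_colStabilizer.2 fun x => ?_, by simp⟩
  · rw [hp, ← hf x]
    rfl
  · have h := congrArg Prod.snd (hf ((p⁻¹ * g) x))
    simp only [← hp, rowCol, Equiv.Perm.mul_apply, perm_apply_inv_self,
      perm_inv_apply_self] at h
    rw [Equiv.Perm.mul_apply, h]

/-! ### Young symmetrizers -/

/-- The sum of the permutations preserving the rows. -/
def rowSum (R : Diagram n) : GroupAlg n := ∑ σ ∈ rowStabilizer R, perm σ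

/-- The signed sum of the permutations preserving the columns. -/
def colSum (R : Diagram n) : GroupAlg n :=
  ∑ σ ∈ colStabilizer R, (((Equiv.Perm.sign σ : ℤˣ) : ℤ) : ℂ) • perm σ

lemma youngSymmetrizer_eq (R : Diagram n) : youngSymmetrizer R = rowSum R * colSum R := rfl

lemma rowSum_mul_perm {R : Diagram n} {p : Equiv.Perm (Fin n)} (hp : p ∈ rowStabilizer R) :
    rowSum R * perm p = rowSum R := by
  rw [mem_rowStabilizer] at hp
  rw [rowSum, Finset.sum_mul]
  refine Finset.sum_equiv (Equiv.mulRight p) (fun σ => ?_) fun σ _ => (perm_mul _ _).symm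
  simp only [mem_rowStabilizer, Equiv.coe_mulRight, Equiv.Perm.mul_apply]
  refine ⟨fun h x => (h _).trans (hp x), fun h x => ?_⟩
  have h1 := h (p⁻¹ x)
  have h2 := hp (p⁻¹ x)
  rw [perm_apply_inv_self] at h1 h2
  rw [h1, h2]

lemma perm_mul_colSum {R : Diagram n} {q : Equiv.Perm (Fin n)} (hq : q ∈ colStabilizer R) :
    perm q * colSum R = (((Equiv.Perm.sign q : ℤˣ) : ℤ) : ℂ) • colSum R := by
  rw [mem_colStabilizer] at hq
  rw [colSum, Finset.mul_sum, Finset.smul_sum]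
  refine Finset.sum_equiv (Equiv.mulLeft q) (fun σ => ?_) fun σ _ => ?_
  · simp only [mem_colStabilizer, Equiv.coe_mulLeft, Equiv.Perm.mul_apply, hq]
  · rw [Equiv.coe_mulLeft, perm_mul, mul_smul_comm, smul_smul, map_mul, Units.val_mul,
      Int.cast_mul, ← mul_assoc, ← Int.cast_mul, ← Units.val_mul, Int.units_mul_self]
    simp

/-- Two points sharing a row and a translated column give a transposition absorbed by `rowSum R` on
the left; moved through `g`, it is absorbed by `colSum R'` with sign `-1`. -/
lemma rowSum_mul_perm_mul_colSum_eq_zero {R R' : Diagram n} {g : Equiv.Perm (Fin n)}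
    (h : ¬ Function.Injective (rowCol R R' g)) : rowSum R * perm g * colSum R' = 0 := by
  classical
  simp only [Function.Injective, not_forall] at h
  obtain ⟨x, y, hxy, hne⟩ := h
  rw [rowCol, rowCol, Prod.mk.injEq] at hxy
  have hrow : Equiv.swap x y ∈ rowStabilizer R := mem_rowStabilizer.2 fun z => by
    rcases eq_or_ne z x with rfl | hx
    · rw [Equiv.swap_apply_left, hxy.1]
    rcases eq_or_ne z y with rfl | hy
    · rw [Equiv.swap_apply_right, hxy.1]
    rw [Equiv.swap_apply_of_ne_of_ne hx hy]
  have hcol : Equiv.swap (g⁻¹ x) (g⁻¹ y) ∈ colStabilizer R' := mem_colStabilizer.2 fun z => by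
    rcases eq_or_ne z (g⁻¹ x) with rfl | hx
    · rw [Equiv.swap_apply_left, hxy.2]
    rcases eq_or_ne z (g⁻¹ y) with rfl | hy
    · rw [Equiv.swap_apply_right, hxy.2]
    rw [Equiv.swap_apply_of_ne_of_ne hx hy]
  have hconj : Equiv.swap x y * g = g * Equiv.swap (g⁻¹ x) (g⁻¹ y) := by
    rw [Equiv.mul_swap_eq_swap_mul, perm_apply_inv_self, perm_apply_inv_self]
  have hkey : rowSum R * perm g * colSum R' = - (rowSum R * perm g * colSum R') := by
    conv_lhs => rw [← rowSum_mul_perm hrow, mul_assoc (rowSum R), ← perm_mul, hconj, perm_mul,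
      ← mul_assoc, mul_assoc _ _ (colSum R'), perm_mul_colSum hcol,
      Equiv.Perm.sign_swap (fun h => hne (g⁻¹.injective h))]
    simp
  rw [eq_neg_iff_add_eq_zero, ← two_smul ℂ] at hkey
  exact (smul_eq_zero_iff_right two_ne_zero).1 hkey

lemma exists_smul_of_forall_perm {f : GroupAlg n →ₗ[ℂ] GroupAlg n} {c : GroupAlg n}
    (h : ∀ g, f (perm g) ∈ Submodule.span ℂ {c}) (x : GroupAlg n) :
    f x ∈ Submodule.span ℂ {c} := by
  induction x using MonoidAlgebra.induction_on with
  | of g => exact h g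
  | add x y hx hy => rw [map_add]; exact Submodule.add_mem _ hx hy
  | smul r x hx => rw [map_smul]; exact Submodule.smul_mem _ _ hx

lemma rowSum_mul_mul_colSum (R : Diagram n) (x : GroupAlg n) :
    ∃ w : ℂ, rowSum R * x * colSum R = w • youngSymmetrizer R := by
  have := exists_smul_of_forall_perm (c := youngSymmetrizer R)
    (f := LinearMap.mulRight ℂ (colSum R) ∘ₗ LinearMap.mulLeft ℂ (rowSum R)) ?_ x
  · obtain ⟨w, hw⟩ := Submodule.mem_span_singleton.1 this
    exact ⟨w, hw.symm⟩
  · intro g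
    change rowSum R * perm g * colSum R ∈ _
    by_cases h : Function.Injective (rowCol R R g)
    · obtain ⟨p, hp, q, hq, rfl⟩ := exists_mul_of_injective_rowCol h
      rw [perm_mul, ← mul_assoc, rowSum_mul_perm hp, mul_assoc, perm_mul_colSum hq,
        mul_smul_comm]
      exact Submodule.smul_mem _ _ (Submodule.mem_span_singleton_self _)
    · rw [rowSum_mul_perm_mul_colSum_eq_zero h]
      exact Submodule.zero_mem _

lemma rowSum_mul_mul_colSum_eq_zero {R R' : Diagram n} (hne : R ≠ R')
    (hle : rowWeight R.1 ≤ rowWeight R'.1) (x : GroupAlg n) :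
    rowSum R * x * colSum R' = 0 :=
  LinearMap.congr_fun (linearMap_ext_perm
    (f := LinearMap.mulRight ℂ (colSum R') ∘ₗ LinearMap.mulLeft ℂ (rowSum R)) (g := 0)
    fun _ => rowSum_mul_perm_mul_colSum_eq_zero
      fun h => hne (eq_of_injective_rowCol h hle)) x

lemma youngSymmetrizer_mul_mul (R : Diagram n) (x : GroupAlg n) :
    ∃ w : ℂ, youngSymmetrizer R * x * youngSymmetrizer R = w • youngSymmetrizer R := by
  obtain ⟨w, hw⟩ := rowSum_mul_mul_colSum R (colSum R * x * rowSum R)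
  exact ⟨w, by rw [← hw, youngSymmetrizer_eq]; simp only [mul_assoc]⟩

lemma youngSymmetrizer_mul_mul_eq_zero {R R' : Diagram n} (hne : R ≠ R')
    (hle : rowWeight R.1 ≤ rowWeight R'.1) (x : GroupAlg n) :
    youngSymmetrizer R * x * youngSymmetrizer R' = 0 := by
  rw [← rowSum_mul_mul_colSum_eq_zero hne hle (colSum R * x * rowSum R'), youngSymmetrizer_eq,
    youngSymmetrizer_eq]
  simp only [mul_assoc]

/-! ### The coefficient of the identity -/

/-- The coefficient of the identity permutation. -/
def coeffOne (n : ℕ) : GroupAlg n →ₗ[ℂ] ℂ :=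
  LinearMap.trace ℂ _ ∘ₗ (((n.factorial : ℂ)⁻¹) • (Algebra.lmul ℂ (GroupAlg n)).toLinearMap)

lemma coeffOne_perm (σ : Equiv.Perm (Fin n)) : coeffOne n (perm σ) = if σ = 1 then 1 else 0 := by
  classical
  have h : LinearMap.trace ℂ _ (Algebra.lmul ℂ (GroupAlg n) (perm σ)) =
      if σ = 1 then (n.factorial : ℂ) else 0 := by
    rw [LinearMap.trace_eq_matrix_trace ℂ (MonoidAlgebra.basis (Equiv.Perm (Fin n)) ℂ),
      Matrix.trace]
    have : ∀ τ, (LinearMap.toMatrix (MonoidAlgebra.basis (Equiv.Perm (Fin n)) ℂ)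
        (MonoidAlgebra.basis (Equiv.Perm (Fin n)) ℂ)
        (Algebra.lmul ℂ (GroupAlg n) (perm σ))).diag τ = if σ = 1 then (1 : ℂ) else 0 := by
      intro τ
      rw [Matrix.diag_apply, LinearMap.toMatrix_apply]
      simp [perm, MonoidAlgebra.basis, Finsupp.single_apply]
    simp only [this, Finset.sum_const, Finset.card_univ, Fintype.card_perm, Fintype.card_fin]
    simp
  have h0 : (n.factorial : ℂ) ≠ 0 := by exact_mod_cast n.factorial_ne_zero
  rw [coeffOne, LinearMap.comp_apply, LinearMap.smul_apply, map_smul]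
  change _ • LinearMap.trace ℂ _ (Algebra.lmul ℂ (GroupAlg n) (perm σ)) = _
  rw [h]
  split_ifs <;> simp [h0]

/-- The identity coefficient is the trace in the regular representation divided by `n!`. -/
lemma coeffOne_of_isNilpotent {x : GroupAlg n} (hx : IsNilpotent x) : coeffOne n x = 0 := by
  have h := LinearMap.isNilpotent_trace_of_isNilpotent (hx.map (Algebra.lmul ℂ (GroupAlg n)))
  rw [coeffOne, LinearMap.comp_apply, LinearMap.smul_apply, map_smul]
  exact smul_eq_zero_of_right _ h.eq_zero

lemma coeffOne_conjTotal (x : GroupAlg n) :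
    coeffOne n (conjTotal n x) = (n.factorial : ℂ) * coeffOne n x := by
  refine LinearMap.congr_fun (linearMap_ext_perm (f := coeffOne n ∘ₗ conjTotal n)
    (g := (n.factorial : ℂ) • coeffOne n) fun σ => ?_) x
  simp [conjTotal_perm, conjSum, coeffOne_perm, Fintype.card_perm, -map_smul]

lemma eq_one_of_mem_stabilizers {R : Diagram n} {σ : Equiv.Perm (Fin n)}
    (hr : σ ∈ rowStabilizer R) (hc : σ ∈ colStabilizer R) : σ = 1 :=
  Equiv.ext fun x => (tableau R).injective
    (Subtype.ext (Prod.ext (mem_rowStabilizer.1 hr x) (mem_colStabilizer.1 hc x)))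

lemma one_mem_rowStabilizer (R : Diagram n) : 1 ∈ rowStabilizer R :=
  mem_rowStabilizer.2 fun _ => rfl

lemma one_mem_colStabilizer (R : Diagram n) : 1 ∈ colStabilizer R :=
  mem_colStabilizer.2 fun _ => rfl

lemma inv_mem_colStabilizer {R : Diagram n} {σ : Equiv.Perm (Fin n)}
    (h : σ ∈ colStabilizer R) : σ⁻¹ ∈ colStabilizer R :=
  mem_colStabilizer.2 fun x => by
    have := mem_colStabilizer.1 h (σ⁻¹ x)
    rw [perm_apply_inv_self] at this
    exact this.symm

/-- The identity arises only as `1 * 1`: if `p * q = 1`, then `p` preserves both rows and columns.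
-/
lemma coeffOne_youngSymmetrizer (R : Diagram n) : coeffOne n (youngSymmetrizer R) = 1 := by
  rw [youngSymmetrizer, Finset.sum_mul, map_sum, Finset.sum_eq_single 1]
  · rw [perm_one, one_mul, map_sum, Finset.sum_eq_single 1]
    · simp [coeffOne_perm]
    · intro q _ hq
      simp [coeffOne_perm, hq]
    · exact fun h => absurd (one_mem_colStabilizer R) h
  · intro p hp hp1
    rw [Finset.mul_sum, map_sum]
    refine Finset.sum_eq_zero fun q hq => ?_
    rw [mul_smul_comm, ← perm_mul, map_smul, coeffOne_perm, if_neg, smul_zero]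
    intro hpq
    rw [mul_eq_one_iff_eq_inv] at hpq
    exact hp1 (eq_one_of_mem_stabilizers hp (hpq ▸ inv_mem_colStabilizer hq))
  · exact fun h => absurd (one_mem_rowStabilizer R) h

lemma youngSymmetrizer_ne_zero (R : Diagram n) : youngSymmetrizer R ≠ 0 := fun h => by
  simpa [h] using coeffOne_youngSymmetrizer R

/-- A central element acts as a scalar on the Young symmetrizer. -/
lemma exists_smul_youngSymmetrizer (R : Diagram n) {z : GroupAlg n} (hz : ∀ y, y * z = z * y) :
    ∃ w : ℂ, z * youngSymmetrizer R = w • youngSymmetrizer R := by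
  obtain ⟨m, hm⟩ := youngSymmetrizer_mul_mul R 1
  rw [mul_one] at hm
  -- Otherwise the symmetrizer would square to zero, against its identity coefficient `1`.
  have hm0 : m ≠ 0 := by
    rintro rfl
    rw [zero_smul] at hm
    have := coeffOne_of_isNilpotent (x := youngSymmetrizer R) ⟨2, by rw [pow_two, hm]⟩
    rw [coeffOne_youngSymmetrizer] at this
    exact one_ne_zero this
  obtain ⟨w, hw⟩ := youngSymmetrizer_mul_mul R z
  rw [hz, mul_assoc, hm, mul_smul_comm] at hw
  exact ⟨m⁻¹ * w, by rw [mul_smul, ← hw, inv_smul_smul₀ hm0]⟩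

/-! ### Central characters of Specht modules and separation of diagrams -/

lemma dim_ne_zero (R : Diagram n) : dim R ≠ 0 := by
  have : Nontrivial (specht R) := ⟨⟨⟨_, 1, one_mul _⟩, 0, fun h =>
    youngSymmetrizer_ne_zero R (congrArg Subtype.val h)⟩⟩
  exact (Module.finrank_pos (R := ℂ) (M := specht R)).ne'

lemma irrep_apply_coe (R : Diagram n) (σ : Equiv.Perm (Fin n)) (v : specht R) :
    (irrep R σ v : GroupAlg n) = perm σ * v := rfl

/-- Every vector is `y * youngSymmetrizer R` and `T_k` commutes past `y`, so neither irreducibility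
nor Schur's lemma is needed. -/
lemma sum_irrep_of_smul {R : Diagram n} {k : ℕ} {w : ℂ}
    (hw : cycleSum n k * youngSymmetrizer R = w • youngSymmetrizer R) :
    ∑ σ ∈ cycleClass n k, irrep R σ = w • LinearMap.id := by
  refine LinearMap.ext fun v => Subtype.ext ?_
  obtain ⟨_, y, rfl⟩ := v
  rw [LinearMap.sum_apply, AddSubmonoidClass.coe_finsetSum]
  simp only [irrep_apply_coe, ← Finset.sum_mul]
  change cycleSum n k * (y * youngSymmetrizer R) = w • (y * youngSymmetrizer R)
  rw [← mul_assoc, ← cycleSum_comm, mul_assoc, hw, mul_smul_comm]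

lemma normalizedCharacter_of_smul {R : Diagram n} {k : ℕ} {w : ℂ}
    (hw : cycleSum n k * youngSymmetrizer R = w • youngSymmetrizer R) :
    normalizedCharacter R k = w := by
  have h := congrArg (LinearMap.trace ℂ (specht R)) (sum_irrep_of_smul hw)
  rw [map_sum, map_smul, LinearMap.trace_id, smul_eq_mul] at h
  rw [normalizedCharacter, div_eq_iff (Nat.cast_ne_zero.2 (dim_ne_zero R))]
  exact h

lemma cycleSum_mul_youngSymmetrizer (R : Diagram n) (k : ℕ) :
    cycleSum n k * youngSymmetrizer R = normalizedCharacter R k • youngSymmetrizer R := by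
  obtain ⟨w, hw⟩ := exists_smul_youngSymmetrizer R (cycleSum_comm k)
  rwa [normalizedCharacter_of_smul hw]

/-- The conjugacy class sums of `k`-cycles act on the Specht module by the normalized characters. -/
theorem sum_irrep (R : Diagram n) (k : ℕ) :
    ∑ σ ∈ cycleClass n k, irrep R σ = normalizedCharacter R k • LinearMap.id :=
  sum_irrep_of_smul (cycleSum_mul_youngSymmetrizer R k)

lemma normalizedCharacter_one (R : Diagram n) (hn : 1 ≤ n) : normalizedCharacter R 1 = 1 :=
  normalizedCharacter_of_smul (by rw [cycleSum_one hn, one_mul, one_smul])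

/-- The point is that one scalar serves both vectors: this property passes from generators to sums
and products. -/
lemma exists_common_eigenvalue {A : Type*} [Ring A] [Algebra ℂ A] {G : Set A} {c c' s : A}
    (hG : ∀ x ∈ G, ∃ w : ℂ, x * c = w • c ∧ x * c' = w • c') (hs : s ∈ Algebra.adjoin ℂ G) :
    ∃ w : ℂ, s * c = w • c ∧ s * c' = w • c' := by
  induction hs using Algebra.adjoin_induction with
  | mem s hs => exact hG s hs
  | algebraMap w => exact ⟨w, (Algebra.smul_def _ _).symm, (Algebra.smul_def _ _).symm⟩
  | add s t _ _ hs ht =>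
    obtain ⟨w, h1, h2⟩ := hs
    obtain ⟨v, h3, h4⟩ := ht
    exact ⟨w + v, by rw [add_mul, add_smul, h1, h3], by rw [add_mul, add_smul, h2, h4]⟩
  | mul s t _ _ hs ht =>
    obtain ⟨w, h1, h2⟩ := hs
    obtain ⟨v, h3, h4⟩ := ht
    exact ⟨v * w, by rw [mul_assoc, h3, mul_smul_comm, h1, mul_smul],
      by rw [mul_assoc, h4, mul_smul_comm, h2, mul_smul]⟩

/-- The normalized characters on generators of the centre separate the Young diagrams. -/
theorem eq_of_normalizedCharacter_eq {K : ℕ}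
    (hK : ∀ σ : Equiv.Perm (Fin n),
      conjSum σ ∈ Algebra.adjoin ℂ {x | ∃ k ∈ Finset.Icc 1 K, x = cycleSum n k})
    {R R' : Diagram n}
    (h : ∀ k ∈ Finset.Icc 1 K, normalizedCharacter R k = normalizedCharacter R' k) : R = R' := by
  by_contra hne
  wlog hle : rowWeight R.1 ≤ rowWeight R'.1 generalizing R R'
  · exact this (fun k hk => (h k hk).symm) (Ne.symm hne) (le_of_not_ge hle)
  have hG : ∀ x ∈ {x : GroupAlg n | ∃ k ∈ Finset.Icc 1 K, x = cycleSum n k}, ∃ w : ℂ,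
      x * youngSymmetrizer R = w • youngSymmetrizer R ∧
        x * youngSymmetrizer R' = w • youngSymmetrizer R' := by
    rintro _ ⟨k, hk, rfl⟩
    exact ⟨_, cycleSum_mul_youngSymmetrizer R k, by
      rw [h k hk]; exact cycleSum_mul_youngSymmetrizer R' k⟩
  obtain ⟨z, hz⟩ : ∃ z, z = conjTotal n (youngSymmetrizer R) := ⟨_, rfl⟩
  have hmem : ∀ x, conjTotal n x ∈
      Algebra.adjoin ℂ {x | ∃ k ∈ Finset.Icc 1 K, x = cycleSum n k} := fun x => by
    induction x using MonoidAlgebra.induction_on with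
    | of σ => exact conjTotal_perm σ ▸ hK σ
    | add x y hx hy => rw [map_add]; exact Subalgebra.add_mem _ hx hy
    | smul r x hx => rw [map_smul]; exact Subalgebra.smul_mem _ hx _
  obtain ⟨w, hw, hw'⟩ := exists_common_eigenvalue hG (hmem (youngSymmetrizer R))
  rw [← hz] at hw hw'
  -- The vanishing is used in one order only, which is why the row weights were ordered beforehand.
  have hz0 : z * youngSymmetrizer R' = 0 := by
    rw [hz, conjTotal_apply, Finset.sum_mul]
    refine Finset.sum_eq_zero fun g _ => ?_
    rw [mul_assoc, youngSymmetrizer_mul_mul_eq_zero hne hle, mul_zero]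
  rw [hz0, eq_comm, smul_eq_zero_iff_left (youngSymmetrizer_ne_zero R')] at hw'
  rw [hw', zero_smul] at hw
  -- In each term `g c g⁻¹ z` of the product, with `c` the symmetrizer of `R`, the central `z` moves
  -- next to `c`, which it kills.
  have hzz : z * z = 0 := by
    have hc : ∀ y, y * z = z * y := hz ▸ conjTotal_comm _
    nth_rw 1 [hz]
    rw [conjTotal_apply, Finset.sum_mul]
    refine Finset.sum_eq_zero fun g _ => ?_
    rw [mul_assoc, mul_assoc, hc, ← mul_assoc (youngSymmetrizer R), hc, hw, zero_mul, mul_zero]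
  have hnil := coeffOne_of_isNilpotent (x := z) ⟨2, by rw [pow_two, hzz]⟩
  rw [hz, coeffOne_conjTotal, coeffOne_youngSymmetrizer, mul_one, Nat.cast_eq_zero] at hnil
  exact n.factorial_ne_zero hnil

/-! ### The eigenvalues on the Fourier subspaces -/

lemma linearMap_comp_sum {ι U V W : Type*} [AddCommMonoid U] [AddCommMonoid V]
    [AddCommMonoid W] [Module ℂ U] [Module ℂ V] [Module ℂ W] (s : Finset ι)
    (f : V →ₗ[ℂ] W) (g : ι → U →ₗ[ℂ] V) :
    f ∘ₗ ∑ i ∈ s, g i = ∑ i ∈ s, f ∘ₗ g i :=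
  map_sum (LinearMap.llcomp ℂ U V W f) g s

lemma linearMap_sum_comp {ι U V W : Type*} [AddCommMonoid U] [AddCommMonoid V]
    [AddCommMonoid W] [Module ℂ U] [Module ℂ V] [Module ℂ W] (s : Finset ι)
    (f : ι → V →ₗ[ℂ] W) (g : U →ₗ[ℂ] V) :
    (∑ i ∈ s, f i) ∘ₗ g = ∑ i ∈ s, f i ∘ₗ g :=
  map_sum (LinearMap.lcomp ℂ W g) f s

lemma sum_irrep_inv (R : Diagram n) (k : ℕ) :
    ∑ σ ∈ cycleClass n k, irrep R σ⁻¹ = normalizedCharacter R k • LinearMap.id := by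
  rw [sum_cycleClass_inv fun σ => irrep R σ, sum_irrep]

/-- The element `∑_{σ₁, σ₂} tr((D(σ₁) ⊗ D(σ₂)) ∘ F) σ₁ ⊗ σ₂`. -/
def traceElement (R R' : Diagram n) (F : Module.End ℂ (specht R ⊗[ℂ] specht R')) : GroupAlg2 n :=
  ∑ σ₁ : Equiv.Perm (Fin n), ∑ σ₂ : Equiv.Perm (Fin n),
    LinearMap.trace ℂ _ (TensorProduct.map (irrep R σ₁) (irrep R' σ₂) ∘ₗ F) • permPair σ₁ σ₂

/-- After reindexing, `D(σ₁) = D(γ⁻¹) D(γσ₁)`, and likewise for `δ`; cyclicity of the trace carries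
the inverse factors to the right of `F`. -/
lemma permPair_mul_traceElement (R R' : Diagram n) (F : Module.End ℂ (specht R ⊗[ℂ] specht R'))
    (γ δ : Equiv.Perm (Fin n)) :
    permPair γ δ * traceElement R R' F =
      traceElement R R' (F ∘ₗ TensorProduct.map (irrep R γ⁻¹) (irrep R' δ⁻¹)) := by
  simp only [traceElement, Finset.mul_sum, mul_smul_comm, permPair_mul]
  refine Fintype.sum_equiv (Equiv.mulLeft γ) _ _ fun σ₁ => ?_
  refine Fintype.sum_equiv (Equiv.mulLeft δ) _ _ fun σ₂ => ?_
  simp only [Equiv.coe_mulLeft]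
  congr 1
  have h : TensorProduct.map (irrep R σ₁) (irrep R' σ₂) =
      TensorProduct.map (irrep R γ⁻¹) (irrep R' δ⁻¹) ∘ₗ
        TensorProduct.map (irrep R (γ * σ₁)) (irrep R' (δ * σ₂)) := by
    rw [← TensorProduct.map_comp, ← Module.End.mul_eq_comp, ← Module.End.mul_eq_comp, ← map_mul,
      ← map_mul, inv_mul_cancel_left, inv_mul_cancel_left]
  rw [h, LinearMap.comp_assoc, ← LinearMap.comp_assoc]
  exact LinearMap.trace_mul_comm ℂ (TensorProduct.map (irrep R γ⁻¹) (irrep R' δ⁻¹))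
    (TensorProduct.map (irrep R (γ * σ₁)) (irrep R' (δ * σ₂)) ∘ₗ F)

lemma traceElement_sum {ι : Type*} (s : Finset ι) (R R' : Diagram n)
    (F : ι → Module.End ℂ (specht R ⊗[ℂ] specht R')) :
    ∑ i ∈ s, traceElement R R' (F i) = traceElement R R' (∑ i ∈ s, F i) := by
  simp only [traceElement]
  rw [Finset.sum_comm]
  refine Finset.sum_congr rfl fun σ₁ _ => ?_
  rw [Finset.sum_comm]
  refine Finset.sum_congr rfl fun σ₂ _ => ?_
  rw [linearMap_comp_sum, map_sum, Finset.sum_smul]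

lemma traceElement_smul (w : ℂ) (R R' : Diagram n) (F : Module.End ℂ (specht R ⊗[ℂ] specht R')) :
    traceElement R R' (w • F) = w • traceElement R R' F := by
  simp only [traceElement, LinearMap.comp_smul, map_smul, smul_eq_mul, mul_smul, Finset.smul_sum]

lemma fourierElement_eq (R : Fin 3 → Diagram n)
    (f : (irrep (R 2)).IntertwiningMap ((irrep (R 0)).tprod (irrep (R 1))))
    (g : ((irrep (R 0)).tprod (irrep (R 1))).IntertwiningMap (irrep (R 2))) :
    fourierElement R f g = ((dim (R 0) : ℂ) * (dim (R 1) : ℂ) / ((n.factorial : ℂ) ^ 2)) •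
      traceElement (R 0) (R 1) (f.toLinearMap ∘ₗ g.toLinearMap) := rfl

lemma sum_permPair_mul_traceElement (R R' : Diagram n)
    (F : Module.End ℂ (specht R ⊗[ℂ] specht R')) (k : ℕ) (w : ℂ)
    (a b : Equiv.Perm (Fin n) → Equiv.Perm (Fin n))
    (h : ∑ σ ∈ cycleClass n k, F ∘ₗ TensorProduct.map (irrep R (a σ)⁻¹) (irrep R' (b σ)⁻¹) =
      w • F) :
    (∑ σ ∈ cycleClass n k, permPair (a σ) (b σ)) * traceElement R R' F =
      w • traceElement R R' F := by
  rw [Finset.sum_mul, ← traceElement_smul, ← h, ← traceElement_sum]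
  exact Finset.sum_congr rfl fun σ _ => permPair_mul_traceElement R R' F _ _

lemma reconnectionElement_mul_traceElement (R : Fin 3 → Diagram n)
    (f : (irrep (R 2)).IntertwiningMap ((irrep (R 0)).tprod (irrep (R 1))))
    (g : ((irrep (R 0)).tprod (irrep (R 1))).IntertwiningMap (irrep (R 2))) (i : Fin 3) (k : ℕ) :
    reconnectionElement n i k *
        traceElement (R 0) (R 1) (f.toLinearMap ∘ₗ g.toLinearMap) =
      normalizedCharacter (R i) k •
        traceElement (R 0) (R 1) (f.toLinearMap ∘ₗ g.toLinearMap) := by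
  fin_cases i
  · change (cycleSum n k ⊗ₜ[ℂ] 1) * _ = normalizedCharacter (R 0) k • _
    rw [cycleSum, TensorProduct.sum_tmul, ← perm_one]
    refine sum_permPair_mul_traceElement (R 0) (R 1) _ k _ id (fun _ => 1) ?_
    rw [← linearMap_comp_sum]
    simp only [id_eq, inv_one, map_one, ← TensorProduct.mapBilinear_apply]
    rw [← LinearMap.sum_apply, ← map_sum, sum_irrep_inv, map_smul, LinearMap.smul_apply,
      TensorProduct.mapBilinear_apply, Module.End.one_eq_id, TensorProduct.map_id,
      LinearMap.comp_smul, LinearMap.comp_id]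
  · change (1 ⊗ₜ[ℂ] cycleSum n k) * _ = normalizedCharacter (R 1) k • _
    rw [cycleSum, TensorProduct.tmul_sum, ← perm_one]
    refine sum_permPair_mul_traceElement (R 0) (R 1) _ k _ (fun _ => 1) id ?_
    rw [← linearMap_comp_sum]
    simp only [id_eq, inv_one, map_one, ← TensorProduct.mapBilinear_apply]
    rw [← map_sum, sum_irrep_inv, map_smul,
      TensorProduct.mapBilinear_apply, Module.End.one_eq_id, TensorProduct.map_id,
      LinearMap.comp_smul, LinearMap.comp_id]
  · change (∑ σ ∈ cycleClass n k, permPair σ σ) * _ = normalizedCharacter (R 2) k • _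
    refine sum_permPair_mul_traceElement (R 0) (R 1) _ k _ id id ?_
    -- Equivariance of `g` turns the diagonal action on `R₁ ⊗ R₂` into the action on `R₃`, where the
    -- class sum is a scalar.
    have hg : ∀ σ, (f.toLinearMap ∘ₗ g.toLinearMap) ∘ₗ
        TensorProduct.map (irrep (R 0) σ⁻¹) (irrep (R 1) σ⁻¹) =
        f.toLinearMap ∘ₗ irrep (R 2) σ⁻¹ ∘ₗ g.toLinearMap := fun σ => by
      rw [LinearMap.comp_assoc]
      exact congrArg (f.toLinearMap ∘ₗ ·) (g.isIntertwining' σ⁻¹)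
    simp only [id_eq, hg]
    rw [← linearMap_comp_sum, ← linearMap_sum_comp, sum_irrep_inv, LinearMap.smul_comp,
      LinearMap.id_comp, LinearMap.comp_smul]

/-- The reconnection operators act on the Fourier subspaces by the normalized characters. -/
theorem reconnectionOperator_apply_of_mem (R : Fin 3 → Diagram n) (i : Fin 3) (k : ℕ)
    {v : ribbonAlgebra n} (hv : v ∈ fourierSubspace R) :
    reconnectionOperator n i k v = normalizedCharacter (R i) k • v := by
  induction hv using Submodule.span_induction with
  | mem v hv =>
    obtain ⟨f, g, rfl⟩ := hv
    refine Subtype.ext ?_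
    change reconnectionElement n i k * fourierElement R f g =
      normalizedCharacter (R i) k • fourierElement R f g
    rw [fourierElement_eq, mul_smul_comm, reconnectionElement_mul_traceElement, smul_comm]
  | zero => rw [map_zero, smul_zero]
  | add v w _ _ hv hw => rw [map_add, smul_add, hv, hw]
  | smul c v _ hv => rw [map_smul, hv, smul_comm]

end RibbonGraph

end

theorem mainTheorem4 (n k : ℕ) (hk : RibbonGraph.kStar n ≤ k) (hkn : k ≤ n) :
    (∀ (R : Fin 3 → RibbonGraph.Diagram n) (i : Fin 3), ∀ j ∈ Finset.Icc 2 k,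
      ∀ v ∈ RibbonGraph.fourierSubspace R,
        RibbonGraph.reconnectionOperator n i j v =
          RibbonGraph.normalizedCharacter (R i) j • v) ∧
    (∀ R R' : Fin 3 → RibbonGraph.Diagram n,
      (∀ i : Fin 3, ∀ j ∈ Finset.Icc 2 k,
        RibbonGraph.normalizedCharacter (R i) j = RibbonGraph.normalizedCharacter (R' i) j) →
      R = R') := by
  refine ⟨fun R i j _ v hv => RibbonGraph.reconnectionOperator_apply_of_mem R i j hv,
    fun R R' h => funext fun i => ?_⟩
  -- An infimum of naturals is attained only for a nonempty set (that of the empty set is `0`); `n`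
  -- is a member.
  have hgen : RibbonGraph.GeneratesCentre n (RibbonGraph.kStar n) :=
    Nat.sInf_mem (s := {K | RibbonGraph.GeneratesCentre n K})
      ⟨n, RibbonGraph.generatesCentre_self n⟩
  refine RibbonGraph.eq_of_normalizedCharacter_eq
    (RibbonGraph.conjSum_mem_adjoin_of_generatesCentre hgen) fun j hj => ?_
  rw [Finset.mem_Icc] at hj
  -- The list of eigenvalues starts at `2`, while the generators include `T_1`. Here `n ≥ 1`, so
  -- `T_1 = 1` has eigenvalue `1` on every diagram.
  rcases hj.1.eq_or_lt with rfl | hj1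
  · have hn : 1 ≤ n := hj.2.trans (hk.trans hkn)
    rw [RibbonGraph.normalizedCharacter_one _ hn, RibbonGraph.normalizedCharacter_one _ hn]
  · exact h i j (Finset.mem_Icc.2 ⟨hj1, hj.2.trans hk⟩)
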